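/- Let $\mathcal{A}n$ be the category of complex analytic manifolds (Hausdorff, second countable, finite-dimensional) and holomorphic maps. For a manifold $S$, a *family of elliptic curves* over $S$ is a triple $(E,\pi,e)$ where $E$ is a complex analytic manifold, $\pi:E\to S$ is a holomorphic submersion, $e:S\to E$ is a holomorphic section of $\pi$, and every fibre $\pi^{-1}(s)$ is a compact connected Riemann surface of genus $1$ (the genus being $\dim H^0(\,\cdot\,;\Omega^1)$). A morphism $(E_1,\pi_1,e_1)\to(E_2,\pi_2,e_2)$ of families over $S$ is a biholomorphism $v:E_1\to E_2$ with $\pi_2\circ v=\pi_1$ and $v\circ e_1=e_2$. Let $\mathcal{M}_{1,1}$ be the pseudofunctor $\mathcal{A}n^{\mathrm{op}}\to\mathrm{Groupoids}$ sending $S$ to the groupoid $\mathcal{M}_{1,1}(S)$ of families of elliptic curves over $S$ and $f:T\to S$ to the pullback functor $f^*E=\{(x,t)\in E\times T\mid \pi(x)=f(t)\}$. For a manifold $M$, let $\underline{M}$ be the pseudofunctor sending $S$ to the set $\mathrm{Mor}_{\mathcal{A}n}(S,M)$, seen as a groupoid with only identity morphisms, with pullback given by composition. **Proposition.** (1) The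 moduli stack $\mathcal{M}_{1,1}$ is not representable by a manifold: there is no complex analytic manifold $M$ such that $\mathcal{M}_{1,1}$ and $\underline{M}$ are equivalent in the $2$-category of pseudofunctors $\mathcal{A}n^{\mathrm{op}}\to\mathrm{Groupoids}$. (2) Moreover, let $\mathscr{C}=\mathbb{C}/(\mathbb{Z}\oplus\mathbb{Z}i)$, which is a compact connected Riemann surface of genus $1$ with marked point $[0]$, put $X=\mathscr{C}$, let $Y=X/(\mathbb{Z}/2)$ be the quotient of $X$ by $[x]\mapsto[x+\tfrac12]$, and let $p:X\to Y$ be the projection. Then $Y$ is a compact connected Riemann surface of genus $1$, and the quotient $E_1$ of $X\times\mathscr{C}$ by the involution $([x],[z])\mapsto([x+\tfrac12],[-z])$, with the projection to $Y$ and the section induced by $([x],[z])\mapsto[x]$ and $[x]\mapsto([x],[0])$, is a family of elliptic curves over $Y$ that is not isomorphic in $\mathcal{M}_{1,1}(Y)$ to the trivial family $Y\times\mathscr{C}$, whereas $p^*E_1$ and $p^*(Y\times\mathscr{C})$ are both isomorphic in $\mathcal{M}_{1,1}(X)$ to the trivial family $X\times\mathscr{C}$. -/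

import Mathlib

open scoped Manifold ContDiff Topology
open CategoryTheory

set_option linter.unusedSectionVars false
set_option linter.unusedVariables false

namespace EllipticStack

/-! ### Fibre products along holomorphic submersions -/

section FibreProduct

variable {VE VS VT F : Type} {E S T : Type}
  [NormedAddCommGroup VE] [NormedSpace ℂ VE] [NormedAddCommGroup VS] [NormedSpace ℂ VS]
  [NormedAddCommGroup VT] [NormedSpace ℂ VT] [NormedAddCommGroup F] [NormedSpace ℂ F]
  [TopologicalSpace E] [ChartedSpace VE E] [TopologicalSpace S] [ChartedSpace VS S]
  [TopologicalSpace T] [ChartedSpace VT T]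

/-- The fibre product `{(x, t) ∈ E × T | p x = f t}`, with the subspace topology. -/
abbrev FibreProd (p : E → S) (f : T → S) : Type := {y : E × T // p y.1 = f y.2}

variable {p : E → S} {f : T → S}

/-- The map `(v, w) ↦ (φ⁻¹(e⁻¹(ψ(f(χ⁻¹ w)), v)), χ⁻¹ w)`, inverse to a chart of the fibre product;
here `φ`, `ψ` are charts of `E`, `S` in which `p` is the linear projection `VE ≃ VS × F → VS`. -/
noncomputable def fibreProdParam {x₀ : E} (f : T → S)
    (h : Manifold.IsSubmersionAtOfComplement F 𝓘(ℂ, VE) 𝓘(ℂ, VS) ω p x₀)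
    (χ : OpenPartialHomeomorph T VT) (w : F × VT) : E × T :=
  (h.domChart.symm (h.equiv.symm (h.codChart (f (χ.symm w.2)), w.1)), χ.symm w.2)

/-- The domain of the coordinates on the fibre product. -/
def fibreProdTarget {x₀ : E} (f : T → S)
    (h : Manifold.IsSubmersionAtOfComplement F 𝓘(ℂ, VE) 𝓘(ℂ, VS) ω p x₀)
    (χ : OpenPartialHomeomorph T VT) : Set (F × VT) :=
  {w | (w.2 ∈ χ.target ∧ f (χ.symm w.2) ∈ h.codChart.source) ∧
    h.equiv.symm (h.codChart (f (χ.symm w.2)), w.1) ∈ h.domChart.target}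

lemma submersion_chart_eq {x₀ : E}
    (h : Manifold.IsSubmersionAtOfComplement F 𝓘(ℂ, VE) 𝓘(ℂ, VS) ω p x₀) {v : VE}
    (hv : v ∈ h.domChart.target) : h.codChart (p (h.domChart.symm v)) = (h.equiv v).1 := by
  have h1 : v ∈ (h.domChart.extend 𝓘(ℂ, VE)).target := by simpa using hv
  simpa using h.writtenInCharts h1

lemma fibreProdParam_mem {x₀ : E}
    (h : Manifold.IsSubmersionAtOfComplement F 𝓘(ℂ, VE) 𝓘(ℂ, VS) ω p x₀)
    (χ : OpenPartialHomeomorph T VT) {w : F × VT} (hw : w ∈ fibreProdTarget f h χ) :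
    p (fibreProdParam f h χ w).1 = f (fibreProdParam f h χ w).2 := by
  obtain ⟨⟨h1, h2⟩, h3⟩ := hw
  have h4 := submersion_chart_eq h h3
  have h5 := h.source_subset_preimage_source (h.domChart.map_target h3)
  refine h.codChart.injOn h5 h2 ?_
  simpa [fibreProdParam] using h4

lemma contMDiffOn_fibreProdParam [IsManifold 𝓘(ℂ, VE) ω E] {x₀ : E}
    (h : Manifold.IsSubmersionAtOfComplement F 𝓘(ℂ, VE) 𝓘(ℂ, VS) ω p x₀)
    (hf : ContMDiff 𝓘(ℂ, VT) 𝓘(ℂ, VS) ω f)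
    {χ : OpenPartialHomeomorph T VT} (hχ : χ ∈ IsManifold.maximalAtlas 𝓘(ℂ, VT) ω T) :
    ContMDiffOn 𝓘(ℂ, F × VT) (𝓘(ℂ, VE).prod 𝓘(ℂ, VT)) ω (fibreProdParam f h χ)
      (fibreProdTarget f h χ) := by
  have hsnd : ContMDiffOn 𝓘(ℂ, F × VT) 𝓘(ℂ, VT) ω (fun w : F × VT => χ.symm w.2)
      (fibreProdTarget f h χ) :=
    (contMDiffOn_symm_of_mem_maximalAtlas hχ).comp (contDiff_snd.contMDiff.contMDiffOn)
      fun w hw => hw.1.1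
  have hψ : ContMDiffOn 𝓘(ℂ, F × VT) 𝓘(ℂ, VS) ω
      (fun w : F × VT => h.codChart (f (χ.symm w.2))) (fibreProdTarget f h χ) :=
    (contMDiffOn_of_mem_maximalAtlas h.codChart_mem_maximalAtlas).comp
      (hf.comp_contMDiffOn hsnd) fun w hw => hw.1.2
  have hlin : ContMDiffOn 𝓘(ℂ, F × VT) 𝓘(ℂ, VE) ω
      (fun w : F × VT => h.equiv.symm (h.codChart (f (χ.symm w.2)), w.1))
      (fibreProdTarget f h χ) :=
    (h.equiv.symm.contDiff.contMDiff).comp_contMDiffOn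
      (contMDiffOn_iff_contDiffOn.2
        ((contMDiffOn_iff_contDiffOn.1 hψ).prodMk contDiff_fst.contDiffOn))
  exact ((contMDiffOn_symm_of_mem_maximalAtlas h.domChart_mem_maximalAtlas).comp hlin
    fun w hw => hw.2).prodMk hsnd

lemma isOpen_fibreProdTarget {x₀ : E}
    (h : Manifold.IsSubmersionAtOfComplement F 𝓘(ℂ, VE) 𝓘(ℂ, VS) ω p x₀)
    (hf : Continuous f) (χ : OpenPartialHomeomorph T VT) :
    IsOpen (fibreProdTarget f h χ) := by
  have c1 : ContinuousOn (fun w : F × VT => f (χ.symm w.2)) (Prod.snd ⁻¹' χ.target) :=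
    hf.comp_continuousOn (χ.continuousOn_symm.comp continuousOn_snd fun w hw => hw)
  have o1 := c1.isOpen_inter_preimage (χ.open_target.preimage continuous_snd)
    h.codChart.open_source
  have c2 : ContinuousOn (fun w : F × VT => h.equiv.symm (h.codChart (f (χ.symm w.2)), w.1))
      (Prod.snd ⁻¹' χ.target ∩ (fun w : F × VT => f (χ.symm w.2)) ⁻¹' h.codChart.source) :=
    h.equiv.symm.continuous.comp_continuousOn
      ((h.codChart.continuousOn.comp (c1.mono fun w hw => hw.1) fun w hw => hw.2).prodMk
        continuousOn_fst)
  exact c2.isOpen_inter_preimage o1 h.domChart.open_target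

open Classical in
/-- A chart of the fibre product: `(x, t) ↦ (pr₂(e(φ x)), χ t)`. -/
noncomputable def fibreProdChartOf [IsManifold 𝓘(ℂ, VE) ω E] {x₀ : E}
    (h : Manifold.IsSubmersionAtOfComplement F 𝓘(ℂ, VE) 𝓘(ℂ, VS) ω p x₀)
    (hf : ContMDiff 𝓘(ℂ, VT) 𝓘(ℂ, VS) ω f)
    (χ : OpenPartialHomeomorph T VT) (hχ : χ ∈ IsManifold.maximalAtlas 𝓘(ℂ, VT) ω T)
    (a : FibreProd p f) :
    OpenPartialHomeomorph (FibreProd p f) (F × VT) where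
  toFun y := ((h.equiv (h.domChart y.1.1)).2, χ y.1.2)
  invFun w := if hw : w ∈ fibreProdTarget f h χ then
    ⟨fibreProdParam f h χ w, fibreProdParam_mem _ _ hw⟩ else a
  source := {y | y.1.1 ∈ h.domChart.source ∧ y.1.2 ∈ χ.source}
  target := fibreProdTarget f h χ
  map_source' y hy := by
    have h1 := h.source_subset_preimage_source hy.1
    have h2 := submersion_chart_eq h (h.domChart.map_source hy.1)
    rw [h.domChart.left_inv hy.1, y.2] at h2
    rw [Set.mem_preimage, y.2] at h1
    refine ⟨⟨χ.map_source hy.2, ?_⟩, ?_⟩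
    · simpa [χ.left_inv hy.2] using h1
    · simp only [χ.left_inv hy.2, h2, Prod.mk.eta,
        ContinuousLinearEquiv.symm_apply_apply]
      exact h.domChart.map_source hy.1
  map_target' w hw := by
    rw [dif_pos hw]
    exact ⟨h.domChart.map_target hw.2, χ.map_target hw.1.1⟩
  left_inv' y hy := by
    have h1 := h.source_subset_preimage_source hy.1
    have h2 := submersion_chart_eq h (h.domChart.map_source hy.1)
    rw [h.domChart.left_inv hy.1, y.2] at h2
    rw [Set.mem_preimage, y.2] at h1
    have h3 : ((h.equiv (h.domChart y.1.1)).2, χ y.1.2) ∈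
        fibreProdTarget f h χ := by
      refine ⟨⟨χ.map_source hy.2, ?_⟩, ?_⟩
      · simpa [χ.left_inv hy.2] using h1
      · simp only [χ.left_inv hy.2, h2, Prod.mk.eta,
          ContinuousLinearEquiv.symm_apply_apply]
        exact h.domChart.map_source hy.1
    rw [dif_pos h3]
    apply Subtype.ext
    simp only [fibreProdParam, χ.left_inv hy.2, h2, Prod.mk.eta,
      ContinuousLinearEquiv.symm_apply_apply, h.domChart.left_inv hy.1]
  right_inv' w hw := by
    rw [dif_pos hw]
    simp only [fibreProdParam, χ.right_inv hw.1.1,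
      h.domChart.right_inv hw.2, ContinuousLinearEquiv.apply_symm_apply, Prod.mk.eta]
  open_source :=
    (h.domChart.open_source.preimage (by fun_prop)).inter
      (χ.open_source.preimage (by fun_prop))
  open_target := isOpen_fibreProdTarget _ hf.continuous _
  continuousOn_toFun := by
    refine ContinuousOn.prodMk ?_ ?_
    · exact ((continuous_snd.comp h.equiv.continuous).comp_continuousOn
        (h.domChart.continuousOn.comp (by fun_prop) fun y hy => hy.1))
    · exact χ.continuousOn.comp (by fun_prop) fun y hy => hy.2
  continuousOn_invFun := by
    refine (Topology.IsInducing.subtypeVal (t := {y : E × T | p y.1 = f y.2})).continuousOn_iff.2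
      ?_
    refine (contMDiffOn_fibreProdParam h hf hχ).continuousOn.congr fun w hw => ?_
    simp only [Function.comp_apply, dif_pos hw]

/-- The preferred chart of the fibre product at `a`. -/
noncomputable def fibreProdChart [IsManifold 𝓘(ℂ, VE) ω E] [IsManifold 𝓘(ℂ, VT) ω T]
    (hp : Manifold.IsSubmersionOfComplement F 𝓘(ℂ, VE) 𝓘(ℂ, VS) ω p)
    (hf : ContMDiff 𝓘(ℂ, VT) 𝓘(ℂ, VS) ω f) (a : FibreProd p f) :
    OpenPartialHomeomorph (FibreProd p f) (F × VT) :=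
  fibreProdChartOf (hp a.1.1) hf (chartAt VT a.1.2) (IsManifold.chart_mem_maximalAtlas a.1.2) a

/-- The atlas of the fibre product. -/
@[reducible] noncomputable def fibreProdChartedSpace [IsManifold 𝓘(ℂ, VE) ω E]
    [IsManifold 𝓘(ℂ, VT) ω T]
    (hp : Manifold.IsSubmersionOfComplement F 𝓘(ℂ, VE) 𝓘(ℂ, VS) ω p)
    (hf : ContMDiff 𝓘(ℂ, VT) 𝓘(ℂ, VS) ω f) : ChartedSpace (F × VT) (FibreProd p f) where
  atlas := Set.range (fibreProdChart hp hf)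
  chartAt := fibreProdChart hp hf
  mem_chart_source a := ⟨(hp a.1.1).mem_domChart_source, mem_chart_source VT a.1.2⟩
  chart_mem_atlas a := ⟨a, rfl⟩

section
variable [IsManifold 𝓘(ℂ, VE) ω E] [IsManifold 𝓘(ℂ, VT) ω T]
    (hp : Manifold.IsSubmersionOfComplement F 𝓘(ℂ, VE) 𝓘(ℂ, VS) ω p)
    (hf : ContMDiff 𝓘(ℂ, VT) 𝓘(ℂ, VS) ω f)

lemma fibreProdChart_symm_val (a : FibreProd p f) {w : F × VT}
    (hw : w ∈ (fibreProdChart hp hf a).target) :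
    ((fibreProdChart hp hf a).symm w).1 = fibreProdParam f (hp a.1.1) (chartAt VT a.1.2) w := by
  have h1 : (fibreProdChart hp hf a).symm w =
      ⟨fibreProdParam f (hp a.1.1) (chartAt VT a.1.2) w, fibreProdParam_mem _ _ hw⟩ :=
    dif_pos hw
  rw [h1]

/-- A chart of the fibre product is the restriction of an analytic map defined on an open subset
of `E × T`. -/
lemma contMDiffOn_fibreProdChart_aux (a : FibreProd p f) :
    ContMDiffOn (𝓘(ℂ, VE).prod 𝓘(ℂ, VT)) 𝓘(ℂ, F × VT) ω
      (fun y : E × T =>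
        (((hp a.1.1).equiv ((hp a.1.1).domChart y.1)).2, chartAt VT a.1.2 y.2))
      ((hp a.1.1).domChart.source ×ˢ (chartAt VT a.1.2).source) := by
  have h1 : ContMDiffOn (𝓘(ℂ, VE).prod 𝓘(ℂ, VT)) 𝓘(ℂ, VE) ω
      (fun y : E × T => (hp a.1.1).domChart y.1)
      ((hp a.1.1).domChart.source ×ˢ (chartAt VT a.1.2).source) :=
    (contMDiffOn_of_mem_maximalAtlas (hp a.1.1).domChart_mem_maximalAtlas).comp
      contMDiffOn_fst fun y hy => hy.1
  have h2 : ContMDiffOn (𝓘(ℂ, VE).prod 𝓘(ℂ, VT)) 𝓘(ℂ, VT) ω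
      (fun y : E × T => chartAt VT a.1.2 y.2)
      ((hp a.1.1).domChart.source ×ˢ (chartAt VT a.1.2).source) :=
    contMDiffOn_chart.comp contMDiffOn_snd fun y hy => hy.2
  have h3 : ContMDiff 𝓘(ℂ, VE) 𝓘(ℂ, F) ω (fun v => ((hp a.1.1).equiv v).2) :=
    (contDiff_snd.comp (hp a.1.1).equiv.contDiff).contMDiff
  rw [modelWithCornersSelf_prod, ← chartedSpaceSelf_prod]
  exact (h3.comp_contMDiffOn h1).prodMk h2

theorem isManifold_fibreProd :
    letI := fibreProdChartedSpace hp hf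
    IsManifold 𝓘(ℂ, F × VT) ω (FibreProd p f) := by
  let _ := fibreProdChartedSpace hp hf
  refine isManifold_of_contDiffOn _ _ _ ?_
  rintro _ _ ⟨a, rfl⟩ ⟨b, rfl⟩
  simp only [modelWithCornersSelf_coe, modelWithCornersSelf_coe_symm, Function.id_comp,
    Function.comp_id, Set.preimage_id_eq, id_eq, Set.range_id, Set.inter_univ]
  rw [← contMDiffOn_iff_contDiffOn]
  have h1 := (contMDiffOn_fibreProdParam (hp a.1.1) hf
    (IsManifold.chart_mem_maximalAtlas (n := ω) (I := 𝓘(ℂ, VT)) a.1.2))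
  have hs : ∀ w ∈ ((fibreProdChart hp hf a).symm ≫ₕ (fibreProdChart hp hf b)).source,
      w ∈ (fibreProdChart hp hf a).target ∧
        (fibreProdChart hp hf a).symm w ∈ (fibreProdChart hp hf b).source := by
    intro w hw
    simpa using hw
  refine ((contMDiffOn_fibreProdChart_aux hp b).comp (h1.mono fun w hw => (hs w hw).1)
    fun w hw => ?_).congr fun w hw => ?_
  · have := (hs w hw).2
    rw [Set.mem_preimage, ← fibreProdChart_symm_val hp hf a (hs w hw).1]
    exact this
  · rw [Function.comp_apply, ← fibreProdChart_symm_val hp hf a (hs w hw).1]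
    rfl

theorem contMDiff_fibreProd_val :
    letI := fibreProdChartedSpace hp hf
    ContMDiff 𝓘(ℂ, F × VT) (𝓘(ℂ, VE).prod 𝓘(ℂ, VT)) ω
      (Subtype.val : FibreProd p f → E × T) := by
  let _ := fibreProdChartedSpace hp hf
  have := isManifold_fibreProd hp hf
  intro a
  have h1 := (contMDiffOn_fibreProdParam (hp a.1.1) hf
    (IsManifold.chart_mem_maximalAtlas (n := ω) (I := 𝓘(ℂ, VT)) a.1.2))
  have h2 : ContMDiffOn 𝓘(ℂ, F × VT) 𝓘(ℂ, F × VT) ω (fibreProdChart hp hf a)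
      (fibreProdChart hp hf a).source := contMDiffOn_chart (x := a)
  have h3 := h1.comp h2 fun y hy => (fibreProdChart hp hf a).map_source hy
  have ha : a ∈ (fibreProdChart hp hf a).source := mem_chart_source (F × VT) a
  refine (h3.contMDiffAt ((fibreProdChart hp hf a).open_source.mem_nhds ha)).congr_of_eventuallyEq
    ?_
  filter_upwards [(fibreProdChart hp hf a).open_source.mem_nhds ha] with y hy
  rw [Function.comp_apply, ← fibreProdChart_symm_val hp hf a
    ((fibreProdChart hp hf a).map_source hy), (fibreProdChart hp hf a).left_inv hy]

/-- Maps into the fibre product are holomorphic as soon as they are so as maps into `E × T`. -/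
theorem contMDiff_fibreProd_of_val {VZ Z : Type} [NormedAddCommGroup VZ] [NormedSpace ℂ VZ]
    [TopologicalSpace Z] [ChartedSpace VZ Z] {g : Z → FibreProd p f}
    (hg : ContMDiff 𝓘(ℂ, VZ) (𝓘(ℂ, VE).prod 𝓘(ℂ, VT)) ω fun z => (g z).1) :
    letI := fibreProdChartedSpace hp hf
    ContMDiff 𝓘(ℂ, VZ) 𝓘(ℂ, F × VT) ω g := by
  let _ := fibreProdChartedSpace hp hf
  have := isManifold_fibreProd hp hf
  have hgc : Continuous g := Topology.IsInducing.subtypeVal.continuous_iff.2 hg.continuous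
  intro z
  rw [contMDiffAt_iff_target]
  refine ⟨hgc.continuousAt, ?_⟩
  have hz : (g z).1 ∈ ((hp (g z).1.1).domChart.source ×ˢ (chartAt VT (g z).1.2).source) :=
    ⟨(hp (g z).1.1).mem_domChart_source, mem_chart_source VT (g z).1.2⟩
  have h1 := ((contMDiffOn_fibreProdChart_aux hp (g z)).contMDiffAt
    (((hp (g z).1.1).domChart.open_source.prod (chartAt VT (g z).1.2).open_source).mem_nhds hz))
  exact ContMDiffAt.comp (g := fun y : E × T => (((hp (g z).1.1).equiv
    ((hp (g z).1.1).domChart y.1)).2, chartAt VT (g z).1.2 y.2)) (f := fun z => (g z).1)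
    z h1 hg.contMDiffAt

theorem isSubmersion_fibreProd_snd :
    letI := fibreProdChartedSpace hp hf
    Manifold.IsSubmersionOfComplement F 𝓘(ℂ, F × VT) 𝓘(ℂ, VT) ω
      (fun y : FibreProd p f => y.1.2) := by
  let _ := fibreProdChartedSpace hp hf
  have := isManifold_fibreProd hp hf
  intro a
  refine Manifold.IsSubmersionAtOfComplement.mk_of_charts (ContinuousLinearEquiv.prodComm ℂ F VT)
    (fibreProdChart hp hf a) (chartAt VT a.1.2) (mem_chart_source (F × VT) a)
    (mem_chart_source VT a.1.2) (IsManifold.chart_mem_maximalAtlas (H := F × VT) a)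
    (IsManifold.chart_mem_maximalAtlas a.1.2) (fun y hy => hy.2) fun w hw => ?_
  have hw' : w ∈ (fibreProdChart hp hf a).target := by simpa using hw
  have h1 := (fibreProdChart hp hf a).right_inv hw'
  have h2 : (chartAt VT a.1.2) ((fibreProdChart hp hf a).symm w).1.2 = w.2 :=
    congrArg Prod.snd h1
  simpa using h2

end
end FibreProduct

/-! ### The category of complex analytic manifolds -/

/-- A complex analytic manifold: a Hausdorff second countable space with a holomorphic atlas
modelled on a finite-dimensional complex vector space `Model`. -/
structure An : Type 1 where
  /-- The underlying set. -/
  carrier : Type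
  /-- The complex vector space on which the manifold is modelled. -/
  Model : Type
  [normedAddCommGroup : NormedAddCommGroup Model]
  [normedSpace : NormedSpace ℂ Model]
  [finiteDimensional : FiniteDimensional ℂ Model]
  [topologicalSpace : TopologicalSpace carrier]
  [chartedSpace : ChartedSpace Model carrier]
  [isManifold : IsManifold 𝓘(ℂ, Model) ω carrier]
  [t2Space : T2Space carrier]
  [secondCountable : SecondCountableTopology carrier]

namespace An

attribute [instance] normedAddCommGroup normedSpace finiteDimensional topologicalSpace
  chartedSpace isManifold t2Space secondCountable

instance : CoeSort An Type := ⟨carrier⟩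

/-- A morphism of complex analytic manifolds is a holomorphic map. -/
@[ext] structure Hom (M N : An) : Type where
  toFun : M → N
  holomorphic : ContMDiff 𝓘(ℂ, M.Model) 𝓘(ℂ, N.Model) ω toFun

instance : Category.{0} An where
  Hom := Hom
  id M := ⟨id, contMDiff_id⟩
  comp f g := ⟨g.toFun ∘ f.toFun, g.holomorphic.comp f.holomorphic⟩

attribute [instance 10000] CategoryStruct.toQuiver

instance (M N : An) : CoeFun (M ⟶ N) fun _ => M → N := ⟨Hom.toFun⟩

@[ext] lemma hom_ext {M N : An} {f g : M ⟶ N} (h : ∀ x, f x = g x) : f = g :=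
  Hom.ext (funext h)

@[simp] lemma id_apply {M : An} (x : M) : (𝟙 M : M ⟶ M) x = x := rfl

@[simp] lemma comp_apply {M N P : An} (f : M ⟶ N) (g : N ⟶ P) (x : M) : (f ≫ g) x = g (f x) := rfl

/-- The complex line. -/
noncomputable def line : An where
  carrier := ℂ
  Model := ℂ

/-- The one-point manifold. -/
noncomputable def pt : An where
  carrier := PUnit
  Model := PUnit

/-- The point `s` of `S`, as a morphism. -/
noncomputable def point {S : An} (s : S) : pt ⟶ S := ⟨fun _ => s, contMDiff_const⟩

/-- The product atlas on `M × N`. -/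
@[reducible] def prodChartedSpace (M N : An) : ChartedSpace (M.Model × N.Model) (M × N) :=
  inferInstanceAs (ChartedSpace (ModelProd M.Model N.Model) (M × N))

theorem isManifold_prod (M N : An) :
    letI := prodChartedSpace M N
    IsManifold 𝓘(ℂ, M.Model × N.Model) ω (M × N) := by
  rw [modelWithCornersSelf_prod]
  exact IsManifold.prod (n := ω) (I := 𝓘(ℂ, M.Model)) (I' := 𝓘(ℂ, N.Model)) M N

/-- The product manifold. -/
noncomputable def prod (M N : An) : An :=
  letI := prodChartedSpace M N
  { carrier := M × N
    Model := M.Model × N.Model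
    isManifold := isManifold_prod M N }

theorem contMDiff_prod_fst (M N : An) :
    letI := prodChartedSpace M N
    ContMDiff 𝓘(ℂ, M.Model × N.Model) 𝓘(ℂ, M.Model) ω (Prod.fst : M × N → M) := by
  rw [modelWithCornersSelf_prod]
  exact contMDiff_fst

theorem contMDiff_prod_snd (M N : An) :
    letI := prodChartedSpace M N
    ContMDiff 𝓘(ℂ, M.Model × N.Model) 𝓘(ℂ, N.Model) ω (Prod.snd : M × N → N) := by
  rw [modelWithCornersSelf_prod]
  exact contMDiff_snd

theorem contMDiff_prod_lift {Z M N : An} (a : Z ⟶ M) (b : Z ⟶ N) :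
    letI := prodChartedSpace M N
    ContMDiff 𝓘(ℂ, Z.Model) 𝓘(ℂ, M.Model × N.Model) ω fun z => (a z, b z) := by
  rw [modelWithCornersSelf_prod]
  exact a.holomorphic.prodMk b.holomorphic

/-- The first projection. -/
noncomputable def fst (M N : An) : prod M N ⟶ M := ⟨Prod.fst, contMDiff_prod_fst M N⟩

/-- The second projection. -/
noncomputable def snd (M N : An) : prod M N ⟶ N := ⟨Prod.snd, contMDiff_prod_snd M N⟩

/-- The morphism `z ↦ (a z, b z)`. -/
noncomputable def prodLift {Z M N : An} (a : Z ⟶ M) (b : Z ⟶ N) : Z ⟶ prod M N :=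
  ⟨fun z => (a z, b z), contMDiff_prod_lift a b⟩

@[simp] lemma prodLift_fst {Z M N : An} (a : Z ⟶ M) (b : Z ⟶ N) : prodLift a b ≫ fst M N = a := rfl

@[simp] lemma prodLift_snd {Z M N : An} (a : Z ⟶ M) (b : Z ⟶ N) : prodLift a b ≫ snd M N = b := rfl

lemma prod_hom_ext {Z M N : An} {a b : Z ⟶ prod M N} (h1 : a ≫ fst M N = b ≫ fst M N)
    (h2 : a ≫ snd M N = b ≫ snd M N) : a = b :=
  hom_ext fun z => Prod.ext (congrArg (fun g : Z ⟶ M => g z) h1)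
    (congrArg (fun g : Z ⟶ N => g z) h2)

/-- `q` identifies `N` with the quotient of `M` by the relation `r`, both as a topological space
and as a complex manifold: it is surjective and locally biholomorphic, and its fibres are the
classes of `r`. -/
def IsQuotientBy {M N : An} (q : M ⟶ N) (r : M → M → Prop) : Prop :=
  Function.Surjective q ∧ IsLocalDiffeomorph 𝓘(ℂ, M.Model) 𝓘(ℂ, N.Model) ω q ∧
    ∀ a b, q a = q b ↔ r a b

/-- A constant morphism. -/
noncomputable def const (M : An) {N : An} (y : N) : M ⟶ N := ⟨fun _ => y, contMDiff_const⟩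

/-- A holomorphic map is a submersion if in suitable charts it is a linear projection. -/
def IsSubmersion {E S : An} (p : E ⟶ S) : Prop :=
  Manifold.IsSubmersion 𝓘(ℂ, E.Model) 𝓘(ℂ, S.Model) ω p

lemma IsSubmersion.exists_complement {E S : An} {p : E ⟶ S} (hp : IsSubmersion p) :
    ∃ (F : Type) (_ : NormedAddCommGroup F) (_ : NormedSpace ℂ F) (_ : FiniteDimensional ℂ F),
      Manifold.IsSubmersionOfComplement F 𝓘(ℂ, E.Model) 𝓘(ℂ, S.Model) ω p := by
  obtain ⟨F, i1, i2, h⟩ := hp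
  by_cases hE : Nonempty E
  · obtain ⟨x⟩ := hE
    have : FiniteDimensional ℂ (S.Model × F) :=
      (h x).equiv.toLinearEquiv.finiteDimensional
    exact ⟨F, i1, i2, FiniteDimensional.of_surjective (LinearMap.snd ℂ S.Model F)
      LinearMap.snd_surjective, h⟩
  · exact ⟨PUnit, inferInstance, inferInstance, inferInstance, fun x => (hE ⟨x⟩).elim⟩

namespace IsSubmersion
variable {E S : An} {p : E ⟶ S} (hp : IsSubmersion p)

/-- The model of the fibres of a submersion. -/
def Fib : Type := hp.exists_complement.choose
noncomputable instance : NormedAddCommGroup hp.Fib := hp.exists_complement.choose_spec.choose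
noncomputable instance : NormedSpace ℂ hp.Fib := hp.exists_complement.choose_spec.choose_spec.choose
instance : FiniteDimensional ℂ hp.Fib :=
  hp.exists_complement.choose_spec.choose_spec.choose_spec.choose
lemma spec : Manifold.IsSubmersionOfComplement hp.Fib 𝓘(ℂ, E.Model) 𝓘(ℂ, S.Model) ω p :=
  hp.exists_complement.choose_spec.choose_spec.choose_spec.choose_spec

end IsSubmersion

/-- The fibre product `{(x, t) ∈ E × T | p x = f t}` of a submersion `p : E ⟶ S` and a morphism
`f : T ⟶ S`. -/
noncomputable def pullback {E S T : An} (p : E ⟶ S) (hp : IsSubmersion p) (f : T ⟶ S) : An :=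
  letI := fibreProdChartedSpace hp.spec f.holomorphic
  { carrier := {y : E × T // p y.1 = f y.2}
    Model := hp.Fib × T.Model
    isManifold := isManifold_fibreProd hp.spec f.holomorphic
    secondCountable := TopologicalSpace.Subtype.secondCountableTopology
      {y : E × T | p y.1 = f y.2} }

section pullback
variable {E S T : An} (p : E ⟶ S) (hp : IsSubmersion p) (f : T ⟶ S)

/-- The projection `(x, t) ↦ x`. -/
noncomputable def pullbackFst : pullback p hp f ⟶ E :=
  ⟨fun y => y.1.1, contMDiff_fst.comp (contMDiff_fibreProd_val hp.spec f.holomorphic)⟩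

/-- The projection `(x, t) ↦ t`. -/
noncomputable def pullbackSnd : pullback p hp f ⟶ T :=
  ⟨fun y => y.1.2, contMDiff_snd.comp (contMDiff_fibreProd_val hp.spec f.holomorphic)⟩

lemma pullback_condition : pullbackFst p hp f ≫ p = pullbackSnd p hp f ≫ f :=
  hom_ext fun y => y.2

lemma isSubmersion_pullbackSnd : IsSubmersion (pullbackSnd p hp f) :=
  ⟨hp.Fib, inferInstance, inferInstance, isSubmersion_fibreProd_snd hp.spec f.holomorphic⟩

variable {p f}

/-- The map `z ↦ (a z, b z)` into the fibre product. -/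
noncomputable def pullbackLift {Z : An} (a : Z ⟶ E) (b : Z ⟶ T) (h : a ≫ p = b ≫ f) :
    Z ⟶ pullback p hp f :=
  ⟨fun z => ⟨(a z, b z), congrArg (fun g : Z ⟶ S => g z) h⟩,
    contMDiff_fibreProd_of_val hp.spec f.holomorphic (a.holomorphic.prodMk b.holomorphic)⟩

@[simp] lemma pullbackLift_fst {Z : An} (a : Z ⟶ E) (b : Z ⟶ T) (h : a ≫ p = b ≫ f) :
    pullbackLift hp a b h ≫ pullbackFst p hp f = a := rfl

@[simp] lemma pullbackLift_snd {Z : An} (a : Z ⟶ E) (b : Z ⟶ T) (h : a ≫ p = b ≫ f) :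
    pullbackLift hp a b h ≫ pullbackSnd p hp f = b := rfl

lemma pullback_hom_ext {Z : An} {a b : Z ⟶ pullback p hp f}
    (h1 : a ≫ pullbackFst p hp f = b ≫ pullbackFst p hp f)
    (h2 : a ≫ pullbackSnd p hp f = b ≫ pullbackSnd p hp f) : a = b :=
  hom_ext fun z => Subtype.ext (Prod.ext (congrArg (fun g : Z ⟶ E => g z) h1)
    (congrArg (fun g : Z ⟶ T => g z) h2))

end pullback

/-- The fibre `p⁻¹(s)` of a submersion, with its structure of complex manifold. -/
noncomputable def fibre {E S : An} (p : E ⟶ S) (hp : IsSubmersion p) (s : S) : An :=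
  pullback p hp (point s)

/-! ### Elliptic curves -/

/-- The space `H⁰(X; Ω¹)` of holomorphic 1-forms on `X`: analytic sections of the holomorphic
cotangent bundle. -/
abbrev HolomorphicForms (X : An) : Type :=
  ContMDiffSection 𝓘(ℂ, X.Model) (X.Model →L[ℂ] ℂ) ω
    (fun x : X => TangentSpace 𝓘(ℂ, X.Model) x →L[ℂ] Bundle.Trivial X ℂ x)

/-- The genus `dim H⁰(X; Ω¹)`. -/
noncomputable def genus (X : An) : ℕ := Module.finrank ℂ X.HolomorphicForms

/-- A compact connected Riemann surface of genus one. Together with a marked point, it is a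
complex elliptic curve. -/
structure IsGenusOneCurve (X : An) : Prop where
  finrank_model : Module.finrank ℂ X.Model = 1
  compactSpace : CompactSpace X
  connectedSpace : ConnectedSpace X
  genus_eq_one : X.genus = 1

end An

/-! ### The moduli stack of elliptic curves -/

open An

/-- A family of elliptic curves parameterised by `S`: a submersion whose fibres are (biholomorphic
to) compact connected Riemann surfaces of genus one, together with a section. -/
structure Family (S : An) : Type 1 where
  /-- The total space. -/
  total : An
  /-- The projection. -/
  proj : total ⟶ S
  isSubmersion : IsSubmersion proj
  /-- The section, marking a point in each fibre. -/
  zero : S ⟶ total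
  zero_proj : zero ≫ proj = 𝟙 S
  fibre_genusOne : ∀ s : S, ∃ C : An, C.IsGenusOneCurve ∧ Nonempty (C ≅ fibre proj isSubmersion s)

namespace Family

variable {S T : An}

/-- A morphism of families over `S`: a biholomorphism of the total spaces over `S` that is
compatible with the sections. -/
structure Hom (E₁ E₂ : Family S) : Type where
  iso : E₁.total ≅ E₂.total
  iso_proj : iso.hom ≫ E₂.proj = E₁.proj
  zero_iso : E₁.zero ≫ iso.hom = E₂.zero

instance : Groupoid.{0} (Family S) where
  Hom := Hom
  id E := ⟨Iso.refl _, Category.id_comp _, Category.comp_id _⟩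
  comp u v := ⟨u.iso ≪≫ v.iso, by
    rw [Iso.trans_hom, Category.assoc, v.iso_proj, u.iso_proj], by
    rw [Iso.trans_hom, ← Category.assoc, u.zero_iso, v.zero_iso]⟩
  inv u := ⟨u.iso.symm, by
    rw [Iso.symm_hom, Iso.inv_comp_eq, u.iso_proj], by
    rw [Iso.symm_hom, Iso.comp_inv_eq, u.zero_iso]⟩
  id_comp u := by cases u; simp
  comp_id u := by cases u; simp
  assoc u v w := by cases u; simp
  inv_comp u := by cases u; simp
  comp_inv u := by cases u; simp

lemma hom_ext' {E₁ E₂ : Family S} {u v : E₁ ⟶ E₂} (h : ∀ x, u.iso.hom x = v.iso.hom x) :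
    u = v := by
  have key : ∀ a b : Hom E₁ E₂, a.iso = b.iso → a = b := by
    rintro ⟨_, _, _⟩ ⟨_, _, _⟩ rfl
    rfl
  exact key u v (Iso.ext (An.hom_ext h))

lemma comp_iso {E₁ E₂ E₃ : Family S} (u : E₁ ⟶ E₂) (v : E₂ ⟶ E₃) :
    (u ≫ v).iso = u.iso ≪≫ v.iso := rfl

lemma id_iso (E : Family S) : Hom.iso (𝟙 E) = Iso.refl _ := rfl

/-- The fibre at `t` of the pulled back family is the fibre at `f t`. -/
noncomputable def fibrePullbackIso {E S T : An} (p : E ⟶ S) (hp : IsSubmersion p) (f : T ⟶ S)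
    (t : T) :
    fibre p hp (f t) ≅ fibre (pullbackSnd p hp f) (isSubmersion_pullbackSnd p hp f) t where
  hom := pullbackLift _ (pullbackLift hp (pullbackFst p hp _) (An.const _ t)
    (An.hom_ext fun y => y.2)) (pullbackSnd p hp _) (An.hom_ext fun _ => rfl)
  inv := pullbackLift _ (pullbackFst _ _ _ ≫ pullbackFst p hp f) (pullbackSnd _ _ _)
    (An.hom_ext fun y => y.1.1.2.trans (congrArg f y.2))
  hom_inv_id := An.hom_ext fun _ => rfl
  inv_hom_id := An.hom_ext fun y => Subtype.ext (Prod.ext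
    (Subtype.ext (Prod.ext rfl y.2.symm)) rfl)

/-- The pullback `f^*E` of a family. -/
noncomputable def pull (f : T ⟶ S) (E : Family S) : Family T where
  total := pullback E.proj E.isSubmersion f
  proj := pullbackSnd E.proj E.isSubmersion f
  isSubmersion := isSubmersion_pullbackSnd _ _ _
  zero := pullbackLift E.isSubmersion (f ≫ E.zero) (𝟙 T) (by
    rw [Category.assoc, E.zero_proj, Category.comp_id, Category.id_comp])
  zero_proj := pullbackLift_snd _ _ _ _
  fibre_genusOne t := by
    obtain ⟨C, hC, ⟨i⟩⟩ := E.fibre_genusOne (f t)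
    exact ⟨C, hC, ⟨i ≪≫ fibrePullbackIso E.proj E.isSubmersion f t⟩⟩

/-- The map between pullbacks induced by a map of total spaces. -/
noncomputable def pullMap (f : T ⟶ S) {E₁ E₂ : Family S} (u : E₁.total ⟶ E₂.total)
    (hu : u ≫ E₂.proj = E₁.proj) : (pull f E₁).total ⟶ (pull f E₂).total :=
  pullbackLift E₂.isSubmersion (pullbackFst E₁.proj E₁.isSubmersion f ≫ u)
    (pullbackSnd E₁.proj E₁.isSubmersion f)
    (An.hom_ext fun y => (congrArg (fun g : E₁.total ⟶ S => g y.1.1) hu).trans y.2)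

/-- The pullback functor `f^*`. -/
noncomputable def pullFunctor (f : T ⟶ S) : Family S ⥤ Family T where
  obj := pull f
  map {E₁ E₂} u := 
    { iso :=
        { hom := pullMap f u.iso.hom u.iso_proj
          inv := pullMap f u.iso.inv (by rw [Iso.inv_comp_eq, u.iso_proj])
          hom_inv_id := An.hom_ext fun y => Subtype.ext (Prod.ext
            (congrArg (fun g : E₁.total ⟶ E₁.total => g y.1.1) u.iso.hom_inv_id) rfl)
          inv_hom_id := An.hom_ext fun y => Subtype.ext (Prod.ext
            (congrArg (fun g : E₂.total ⟶ E₂.total => g y.1.1) u.iso.inv_hom_id) rfl) }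
      iso_proj := rfl
      zero_iso := An.hom_ext fun t => Subtype.ext (Prod.ext
        (congrArg (fun g : S ⟶ E₂.total => g (f t)) u.zero_iso) rfl) }
  map_id _ := hom_ext' fun _ => rfl
  map_comp _ _ := hom_ext' fun _ => rfl

/-- The canonical isomorphism `id^*E ≃ E`. -/
noncomputable def pullId (S : An) : pullFunctor (𝟙 S) ≅ 𝟭 (Family S) :=
  NatIso.ofComponents (fun E => (Groupoid.isoEquivHom _ _).symm
    { iso :=
        { hom := pullbackFst E.proj E.isSubmersion (𝟙 S)
          inv := pullbackLift E.isSubmersion (𝟙 _) E.proj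
            (by rw [Category.id_comp, Category.comp_id])
          hom_inv_id := An.hom_ext fun y => Subtype.ext (Prod.ext rfl y.2)
          inv_hom_id := rfl }
      iso_proj := An.hom_ext fun y => y.2
      zero_iso := rfl })
    fun _ => hom_ext' fun _ => rfl

/-- The canonical isomorphism `(f ∘ g)^*E ≃ g^*(f^*E)`. -/
noncomputable def pullComp {U : An} (g : U ⟶ T) (f : T ⟶ S) :
    pullFunctor (g ≫ f) ≅ pullFunctor f ⋙ pullFunctor g :=
  NatIso.ofComponents (fun E => (Groupoid.isoEquivHom _ _).symm
    { iso :=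
        { hom := pullbackLift (pull f E).isSubmersion
            (pullbackLift E.isSubmersion (pullbackFst E.proj E.isSubmersion (g ≫ f))
              (pullbackSnd E.proj E.isSubmersion (g ≫ f) ≫ g)
              (An.hom_ext fun y => y.2))
            (pullbackSnd E.proj E.isSubmersion (g ≫ f)) rfl
          inv := pullbackLift E.isSubmersion
            (pullbackFst (pull f E).proj (pull f E).isSubmersion g ≫
              pullbackFst E.proj E.isSubmersion f)
            (pullbackSnd (pull f E).proj (pull f E).isSubmersion g)
            (An.hom_ext fun y => y.1.1.2.trans (congrArg f y.2))
          hom_inv_id := rfl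
          inv_hom_id := An.hom_ext fun y => Subtype.ext (Prod.ext
            (Subtype.ext (Prod.ext rfl y.2.symm)) rfl) }
      iso_proj := rfl
      zero_iso := rfl })
    fun _ => hom_ext' fun _ => rfl

lemma isSubmersion_prod_fst (S C : An) :
    letI := prodChartedSpace S C
    Manifold.IsSubmersionOfComplement C.Model 𝓘(ℂ, S.Model × C.Model) 𝓘(ℂ, S.Model) ω
      (Prod.fst : S × C → S) := by
  let _ := prodChartedSpace S C
  have := isManifold_prod S C
  intro x
  refine Manifold.IsSubmersionAtOfComplement.mk_of_charts
    (ContinuousLinearEquiv.refl ℂ (S.Model × C.Model))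
    (chartAt (S.Model × C.Model) x) (chartAt S.Model x.1)
    (mem_chart_source (S.Model × C.Model) x) (mem_chart_source _ _)
    (IsManifold.chart_mem_maximalAtlas (H := S.Model × C.Model) x)
    (IsManifold.chart_mem_maximalAtlas x.1) (fun y hy => hy.1) fun w hw => ?_
  have hw' : w ∈ (chartAt (S.Model × C.Model) x).target := by simpa using hw
  have h2 : (chartAt S.Model x.1) ((chartAt (S.Model × C.Model) x).symm w).1 = w.1 :=
    congrArg Prod.fst ((chartAt (S.Model × C.Model) x).right_inv hw')
  simpa using h2

/-- The projection `S × C ⟶ S` is a submersion. -/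
lemma isSubmersion_fst (S C : An) : IsSubmersion (An.fst S C) :=
  ⟨C.Model, inferInstance, inferInstance, isSubmersion_prod_fst S C⟩

/-- The fibres of `S × C ⟶ S` are copies of `C`. -/
noncomputable def fibreFstIso (S C : An) (s : S) :
    C ≅ fibre (An.fst S C) (isSubmersion_fst S C) s where
  hom := pullbackLift _ (prodLift (An.const C s) (𝟙 C)) (An.const C PUnit.unit) rfl
  inv := pullbackFst _ _ _ ≫ An.snd S C
  hom_inv_id := rfl
  inv_hom_id := An.hom_ext fun y => Subtype.ext (Prod.ext (Prod.ext y.2.symm rfl) rfl)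

/-- The trivial family `S × C` with fibre the elliptic curve `(C, e)`. -/
noncomputable def trivial (S C : An) (hC : C.IsGenusOneCurve) (e : C) : Family S where
  total := prod S C
  proj := An.fst S C
  isSubmersion := isSubmersion_fst S C
  zero := prodLift (𝟙 S) (An.const S e)
  zero_proj := rfl
  fibre_genusOne s := ⟨C, hC, ⟨fibreFstIso S C s⟩⟩

end Family

/-- A prestack on the category of complex analytic manifolds: a contravariant pseudofunctor with
values in groupoids. -/
structure Prestack where
  toPseudofunctor : Pseudofunctor (LocallyDiscrete Anᵒᵖ) Cat.{0, 1}
  isGroupoid : ∀ S, IsGroupoid (toPseudofunctor.obj S)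

/-- The prestack of families of elliptic curves. -/
noncomputable def M₁₁ : Prestack where
  toPseudofunctor := LocallyDiscrete.mkPseudofunctor
    (fun S => Cat.of (Family S.unop))
    (fun f => (Family.pullFunctor f.unop).toCatHom)
    (fun S => Cat.Hom.isoMk (Family.pullId S.unop))
    (fun f g => Cat.Hom.isoMk (Family.pullComp g.unop f.unop))
    (fun f g h => by
      refine Cat.Hom₂.ext (NatTrans.ext (funext fun E => Family.hom_ext' fun x => ?_))
      rfl)
    (fun f => by
      refine Cat.Hom₂.ext (NatTrans.ext (funext fun E => Family.hom_ext' fun x => ?_))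
      rfl)
    (fun f => by
      refine Cat.Hom₂.ext (NatTrans.ext (funext fun E => Family.hom_ext' fun x => ?_))
      rfl)
  isGroupoid S := (inferInstance : IsGroupoid (Family S.as.unop))

/-- The set `Mor(S, X)`, as a groupoid with only identity morphisms. -/
structure Points (X S : An) : Type 1 where
  map : S ⟶ X

namespace Points

variable {X S T : An}

instance : Groupoid.{0} (Points X S) where
  Hom u v := PLift (u.map = v.map)
  id _ := ⟨rfl⟩
  comp a b := ⟨a.down.trans b.down⟩
  inv a := ⟨a.down.symm⟩

lemma subsingleton_hom {u v : Points X S} (a b : u ⟶ v) : a = b := Subsingleton.elim (α := PLift _) a b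

/-- The functor `u ↦ u ∘ f`. -/
def pullFunctor (X : An) (f : T ⟶ S) : Points X S ⥤ Points X T where
  obj u := ⟨f ≫ u.map⟩
  map a := ⟨congrArg (f ≫ ·) a.down⟩

end Points

/-- The prestack `S ↦ Mor(S, X)` defined by a manifold `X`. -/
def An.toPrestack (X : An) : Prestack where
  toPseudofunctor := LocallyDiscrete.mkPseudofunctor
    (fun S => Cat.of (Points X S.unop))
    (fun f => (Points.pullFunctor X f.unop).toCatHom)
    (fun S => Cat.Hom.isoMk (NatIso.ofComponents (fun u => Iso.refl _) fun _ => rfl))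
    (fun f g => Cat.Hom.isoMk (NatIso.ofComponents (fun u => Iso.refl _) fun _ => rfl))
    (fun f g h => Cat.Hom₂.ext (NatTrans.ext (funext fun _ => Points.subsingleton_hom _ _)))
    (fun f => Cat.Hom₂.ext (NatTrans.ext (funext fun _ => Points.subsingleton_hom _ _)))
    (fun f => Cat.Hom₂.ext (NatTrans.ext (funext fun _ => Points.subsingleton_hom _ _)))
  isGroupoid S := (inferInstance : IsGroupoid (Points X S.as.unop))

open scoped Pseudofunctor.StrongTrans in
/-- A prestack is representable by the manifold `X` if it is equivalent to `Mor(-, X)` in the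
2-category of prestacks. -/
def Prestack.IsRepresentableBy (F : Prestack) (X : An) : Prop :=
  Nonempty (Bicategory.Equivalence F.toPseudofunctor X.toPrestack.toPseudofunctor)

end EllipticStack

namespace EllipticStack

open Function Set

namespace An

/-! ### Local biholomorphisms and quotient manifolds -/

section Descent

variable {M N P : An} {q : M → N}

/-! Representability fails because of automorphisms. An equivalence with `Mor(-, M)` is faithful on
each groupoid, and the groupoid of points of `M` has only identities, so no family could have a
nontrivial automorphism (`Prestack.IsRepresentableBy.aut_eq`). But `[z] ↦ [-z]` on `ℂ / (ℤ + ℤ i)`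
fixes `[0]` and moves `[1/4]`, which gives a nontrivial automorphism of a family over a point.

For the second part, the same involution is used as gluing datum. Quotients by free involutions and
by lattices are complex manifolds, since local sections of the quotient map differ by holomorphic
deck transformations (`exists_quotient`). A compact quotient of `ℂ` by translations has genus one:
`dz` descends, and any other form is a holomorphic function times it, hence a constant times it
(`isGenusOneCurve_of_translations`). The twisted product `(X × C) / (ℤ/2)` is locally biholomorphic
to `X × C`, so its projection is a submersion, and `(x, z) ↦ (q (x, z), x)` trivialises it over `X`
(`exists_iso_pullback_twist`).

Nontriviality is a monodromy argument (`eq_zero_of_twisted_invariant`). A trivialisation would give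
pointed maps `φ x : X → X`, injective and holomorphic, with `φ (x + 1/2) (-z) = φ x z`. The
homomorphism that `φ x` induces on the lattice is discrete data, hence independent of `x`; the twist
makes it equal to its own negative, so it vanishes. Then `φ 0` lifts to a holomorphic map from the
compact curve to `ℂ`, which is constant. This contradicts injectivity. -/

lemma contMDiffAt_of_comp_localDiffeomorph {VZ Z : Type} [NormedAddCommGroup VZ] [NormedSpace ℂ VZ]
    [TopologicalSpace Z] [ChartedSpace VZ Z] {g : Z → M} {z : Z}
    (hq : IsLocalDiffeomorphAt 𝓘(ℂ, M.Model) 𝓘(ℂ, N.Model) ω q (g z)) (hg : ContinuousAt g z)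
    (h : ContMDiffAt 𝓘(ℂ, VZ) 𝓘(ℂ, N.Model) ω (q ∘ g) z) :
    ContMDiffAt 𝓘(ℂ, VZ) 𝓘(ℂ, M.Model) ω g z := by
  refine (ContMDiffAt.comp (g := hq.localInverse) z hq.localInverse_contMDiffAt h
    ).congr_of_eventuallyEq ?_
  -- Continuity of `g` keeps `g y` in the region where the local inverse undoes `q`.
  filter_upwards [hg.eventually hq.localInverse_eventuallyEq_left] with y hy
  exact hy.symm

lemma contMDiff_of_comp_localDiffeomorph {VZ Z : Type} [NormedAddCommGroup VZ] [NormedSpace ℂ VZ]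
    [TopologicalSpace Z] [ChartedSpace VZ Z] {g : Z → M}
    (hq : IsLocalDiffeomorph 𝓘(ℂ, M.Model) 𝓘(ℂ, N.Model) ω q) (hg : Continuous g)
    (h : ContMDiff 𝓘(ℂ, VZ) 𝓘(ℂ, N.Model) ω (q ∘ g)) :
    ContMDiff 𝓘(ℂ, VZ) 𝓘(ℂ, M.Model) ω g :=
  fun z => contMDiffAt_of_comp_localDiffeomorph (hq _) hg.continuousAt (h z)

/-- Near `q x`, the map `g` is `g ∘ q` composed with a local inverse of `q`. This is how holomorphic
maps are descended to every quotient below. -/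
lemma contMDiff_of_localDiffeomorph_comp {VZ Z : Type} [NormedAddCommGroup VZ] [NormedSpace ℂ VZ]
    [TopologicalSpace Z] [ChartedSpace VZ Z] {g : N → Z} (hs : Surjective q)
    (hq : IsLocalDiffeomorph 𝓘(ℂ, M.Model) 𝓘(ℂ, N.Model) ω q)
    (h : ContMDiff 𝓘(ℂ, M.Model) 𝓘(ℂ, VZ) ω (g ∘ q)) :
    ContMDiff 𝓘(ℂ, N.Model) 𝓘(ℂ, VZ) ω g := by
  intro y
  obtain ⟨x, rfl⟩ := hs y
  refine (ContMDiffAt.comp (f := (hq x).localInverse) (q x) (h _)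
    (hq x).localInverse_contMDiffAt).congr_of_eventuallyEq ?_
  filter_upwards [(hq x).localInverse_eventuallyEq_right] with y hy
  exact (congrArg g hy).symm

/-- A function that is constant on the fibres of a quotient map descends. -/
lemma IsQuotientBy.exists_desc_fun {r : M → M → Prop} {q : M ⟶ N} (hq : IsQuotientBy q r)
    {VZ Z : Type} [NormedAddCommGroup VZ] [NormedSpace ℂ VZ]
    [TopologicalSpace Z] [ChartedSpace VZ Z] {g : M → Z}
    (hg : ContMDiff 𝓘(ℂ, M.Model) 𝓘(ℂ, VZ) ω g) (h : ∀ a b, r a b → g a = g b) :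
    ∃ g' : N → Z, ContMDiff 𝓘(ℂ, N.Model) 𝓘(ℂ, VZ) ω g' ∧ ∀ a, g' (q a) = g a := by
  have key : ∀ a, g (surjInv hq.1 (q a)) = g a := fun a =>
    h _ _ ((hq.2.2 _ _).1 (surjInv_eq hq.1 (q a)))
  refine ⟨fun y => g (surjInv hq.1 y), ?_, key⟩
  refine contMDiff_of_localDiffeomorph_comp hq.1 hq.2.1 ?_
  rwa [show (fun y => g (surjInv hq.1 y)) ∘ q = g from funext key]

lemma IsQuotientBy.exists_desc {r : M → M → Prop} {q : M ⟶ N} (hq : IsQuotientBy q r)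
    (g : M ⟶ P) (h : ∀ a b, r a b → g a = g b) : ∃ g' : N ⟶ P, ∀ a, g' (q a) = g a := by
  obtain ⟨g', h1, h2⟩ := hq.exists_desc_fun g.holomorphic h
  exact ⟨⟨g', h1⟩, h2⟩

end Descent

/-! ### Complex structures on quotients by deck transformations -/

section Quotient

variable {M : An} {N : Type} [TopologicalSpace N] {q : M → N}

/-- Near `x` the composite `s ∘ q` is the deck transformation `g` that carries `x` to `s (q x)`:
both points `g y` and `s (q y)` lie in the sheet `s.target` over `q y`. -/
lemma contMDiffAt_localSection_comp (hc : Continuous q)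
    (hd : ∀ a b, q a = q b → ∃ g : M ⟶ M, g a = b ∧ ∀ x, q (g x) = q x)
    (s : OpenPartialHomeomorph N M) (hs : s.symm = q) {x : M} (hx : q x ∈ s.source) :
    ContMDiffAt 𝓘(ℂ, M.Model) 𝓘(ℂ, M.Model) ω (fun y => s (q y)) x := by
  obtain ⟨g, hg, hgq⟩ := hd x (s (q x)) (by rw [← hs]; exact (s.left_inv (by rwa [hs])).symm)
  refine g.holomorphic.contMDiffAt.congr_of_eventuallyEq ?_
  have h1 : ∀ᶠ y in 𝓝 x, g y ∈ s.target :=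
    g.holomorphic.continuous.continuousAt.eventually_mem
      (s.open_target.mem_nhds (hg ▸ s.map_source hx))
  filter_upwards [h1] with y hy
  rw [← hgq y, ← hs, s.right_inv hy]

/-- If the fibres of a surjective local homeomorphism are permuted transitively by holomorphic
deck transformations, then its target is a complex manifold. -/
theorem exists_quotient [T2Space N] (hq : IsLocalHomeomorph q) (hs : Surjective q)
    (hd : ∀ a b, q a = q b → ∃ g : M ⟶ M, g a = b ∧ ∀ x, q (g x) = q x) :
    ∃ (N' : An) (e : N ≃ₜ N') (q' : M ⟶ N'), (∀ x, q' x = e (q x)) ∧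
      IsLocalDiffeomorph 𝓘(ℂ, M.Model) 𝓘(ℂ, N'.Model) ω q' := by
  -- The charts of `N` are local sections of `q` followed by charts of `M`. Transition maps, `q` and
  -- its local sections, read in these charts, all take the form `s ∘ q` up to charts of `M`, so
  -- `hsec` settles each of them.
  let _ : ChartedSpace M.Model N := hq.chartedSpaceOfRightInverse (rightInverse_surjInv hs)
  have hsc : SecondCountableTopology N :=
    (hq.isOpenMap.isQuotientMap hq.continuous hs).secondCountableTopology hq.isOpenMap
  let g := surjInv hs
  have hgs : ∀ y, y ∈ (hq.localInverseAt (g y)).source := fun y => by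
    simpa [g, surjInv_eq hs y] using hq.apply_self_mem_localInverseAt_source (x := g y)
  have hgy : ∀ y, hq.localInverseAt (g y) y = g y := fun y => by
    simpa [g, surjInv_eq hs y] using hq.localInverseAt_apply_self (x := g y)
  have hsec : ∀ (s : OpenPartialHomeomorph N M), s.symm = q → ∀ x, q x ∈ s.source →
      ContMDiffAt 𝓘(ℂ, M.Model) 𝓘(ℂ, M.Model) ω (fun y => s (q y)) x :=
    fun s h x hx => contMDiffAt_localSection_comp hq.continuous hd s h hx
  have hM : IsManifold 𝓘(ℂ, M.Model) ω N := by
    refine isManifold_of_contDiffOn _ _ _ ?_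
    rintro _ _ ⟨a, rfl⟩ ⟨b, rfl⟩
    simp only [modelWithCornersSelf_coe, modelWithCornersSelf_coe_symm, Function.id_comp,
      Function.comp_id, Set.preimage_id_eq, id_eq, Set.range_id, Set.inter_univ]
    rw [← contMDiffOn_iff_contDiffOn]
    intro w hw
    simp only [OpenPartialHomeomorph.trans_source, OpenPartialHomeomorph.symm_source,
      OpenPartialHomeomorph.trans_target, mem_inter_iff, mem_preimage,
      OpenPartialHomeomorph.coe_trans_symm, IsLocalHomeomorph.localInverseAt_symm]
      at hw
    obtain ⟨⟨h1, h2⟩, h3, h4⟩ := hw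
    have c1 : ContMDiffAt 𝓘(ℂ, M.Model) 𝓘(ℂ, M.Model) ω (chartAt M.Model (g a)).symm w :=
      (contMDiffOn_chart_symm (x := g a)).contMDiffAt
        ((chartAt M.Model (g a)).open_target.mem_nhds h1)
    have c3 : ContMDiffAt 𝓘(ℂ, M.Model) 𝓘(ℂ, M.Model) ω (chartAt M.Model (g b))
        (hq.localInverseAt (g b) (q ((chartAt M.Model (g a)).symm w))) :=
      (contMDiffOn_chart (x := g b)).contMDiffAt
        ((chartAt M.Model (g b)).open_source.mem_nhds h4)
    refine ContMDiffAt.contMDiffWithinAt ?_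
    have := c3.comp w ((hsec _ (hq.localInverseAt_symm (g b)) _ h3).comp w c1)
    refine this.congr_of_eventuallyEq (Filter.Eventually.of_forall fun v => ?_)
    simp [g]
  let N' : An := { carrier := N, Model := M.Model }
  have hq1 : ContMDiff 𝓘(ℂ, M.Model) 𝓘(ℂ, M.Model) ω q := by
    intro x
    rw [contMDiffAt_iff_target]
    refine ⟨hq.continuous.continuousAt, ?_⟩
    have c3 : ContMDiffAt 𝓘(ℂ, M.Model) 𝓘(ℂ, M.Model) ω (chartAt M.Model (g (q x)))
        (hq.localInverseAt (g (q x)) (q x)) := by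
      rw [hgy]
      exact contMDiffAt_of_mem_maximalAtlas (IsManifold.chart_mem_maximalAtlas _)
        (mem_chart_source M.Model (g (q x)))
    exact ContMDiffAt.comp (f := fun y => hq.localInverseAt (g (q x)) (q y)) x c3
      (hsec _ (hq.localInverseAt_symm (g (q x))) _ (hgs _))
  have hq2 : ∀ x, ContMDiffOn 𝓘(ℂ, M.Model) 𝓘(ℂ, M.Model) ω (hq.localInverseAt x)
      (hq.localInverseAt x).source := by
    intro x y hy
    refine ContMDiffAt.contMDiffWithinAt ?_
    rw [contMDiffAt_iff_source]
    have e1 : extChartAt 𝓘(ℂ, M.Model) y y = chartAt M.Model (g y) (g y) :=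
      congrArg (chartAt M.Model (g y)) (hgy y)
    have c1 : ContMDiffAt 𝓘(ℂ, M.Model) 𝓘(ℂ, M.Model) ω (chartAt M.Model (g y)).symm
        (chartAt M.Model (g y) (g y)) :=
      (contMDiffOn_chart_symm (x := g y)).contMDiffAt
        ((chartAt M.Model (g y)).open_target.mem_nhds (mem_chart_target _ _))
    have e2 : (chartAt M.Model (g y)).symm (chartAt M.Model (g y) (g y)) = g y :=
      (chartAt M.Model (g y)).left_inv (mem_chart_source _ _)
    have c2 := hsec _ (hq.localInverseAt_symm x) (g y) (by rwa [surjInv_eq hs])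
    rw [e1]
    refine ContMDiffAt.contMDiffWithinAt ?_
    refine (ContMDiffAt.comp (g := fun z => hq.localInverseAt x (q z)) _ (by rwa [e2]) c1
      ).congr_of_eventuallyEq
      (Filter.Eventually.of_forall fun v => ?_)
    have e3 : (chartAt M.Model y).symm v = q ((chartAt M.Model (g y)).symm v) :=
      congrFun (hq.localInverseAt_symm (g y)) _
    simp [e3]
  refine ⟨N', Homeomorph.refl N, ⟨q, hq1⟩, fun _ => rfl, fun x => ?_⟩
  refine ⟨{ toPartialEquiv := (hq.localInverseAt x).symm.toPartialEquiv
            open_source := (hq.localInverseAt x).open_target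
            open_target := (hq.localInverseAt x).open_source
            contMDiffOn_toFun := ?_
            contMDiffOn_invFun := hq2 x }, hq.self_mem_localInverseAt_target, fun y hy => ?_⟩
  · exact hq1.contMDiffOn.congr fun y _ => congrFun (hq.localInverseAt_symm x) y
  · exact (congrFun (hq.localInverseAt_symm x) y).symm

end Quotient

/-- The quotient of a manifold by a fixed point free holomorphic involution. -/
theorem exists_quotient_involution {M : An} (σ : M ⟶ M) (h2 : ∀ x, σ (σ x) = x)
    (hfree : ∀ x, σ x ≠ x) :
    ∃ (N : An) (q : M ⟶ N), IsQuotientBy q (fun a b => b = a ∨ b = σ a) := by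
  have : LocallyCompactSpace M := ChartedSpace.locallyCompactSpace M.Model M
  -- The involution is turned into a group of order at most two: a finite group acting freely by
  -- homeomorphisms on a locally compact Hausdorff space acts properly discontinuously, so the orbit
  -- map is a covering.
  let s : Equiv.Perm M := ⟨σ, σ, h2, h2⟩
  have hss : s * s = 1 := Equiv.ext h2
  let G : Subgroup (Equiv.Perm M) :=
    { carrier := {1, s}
      mul_mem' := by
        rintro a b (rfl | rfl) (rfl | rfl) <;> simp [hss]
      one_mem' := by simp
      inv_mem' := by
        rintro a (rfl | rfl)
        · simp
        · right; exact inv_eq_of_mul_eq_one_left hss }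
  have hG : ∀ g : G, ∃ γ : M ⟶ M, (∀ x, γ x = g • x) ∧ ((∀ x : M, g • x = x) ∨ ∀ x : M, g • x = σ x) := by
    rintro ⟨g, rfl | rfl⟩
    · exact ⟨𝟙 M, fun _ => rfl, Or.inl fun _ => rfl⟩
    · exact ⟨σ, fun _ => rfl, Or.inr fun _ => rfl⟩
  have : Finite G := (Set.toFinite ({1, s} : Set (Equiv.Perm M))).to_subtype
  have : ContinuousConstSMul G M := ⟨fun g => by
    obtain ⟨γ, hγ, -⟩ := hG g
    exact γ.holomorphic.continuous.congr hγ⟩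
  have : IsCancelSMul G M := isCancelSMul_iff_eq_one_of_smul_eq.2 <| by
    rintro ⟨g, rfl | rfl⟩ x hx
    · rfl
    · exact (hfree x hx).elim
  have hq := isQuotientCoveringMap_quotientMk_of_properlyDiscontinuousSMul (G := G) (E := M)
  have horb : ∀ a b : M, Quotient.mk (MulAction.orbitRel G M) a = Quotient.mk _ b ↔
      b = a ∨ b = σ a := by
    intro a b
    rw [eq_comm, hq.apply_eq_iff_mem_orbit]
    constructor
    · rintro ⟨g, rfl⟩
      obtain ⟨-, -, h | h⟩ := hG g
      · exact Or.inl (h a)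
      · exact Or.inr (h a)
    · rintro (rfl | rfl)
      · exact MulAction.mem_orbit_self _
      · exact ⟨⟨s, Or.inr rfl⟩, rfl⟩
  obtain ⟨N, e, q, hqe, hql⟩ := exists_quotient (M := M) hq.isCoveringMap.isLocalHomeomorph
    hq.surjective (fun a b hab => by
      obtain rfl | rfl := (horb a b).1 hab
      · exact ⟨𝟙 M, rfl, fun _ => rfl⟩
      · exact ⟨σ, rfl, fun x => ((horb x (σ x)).2 (Or.inr rfl)).symm⟩)
  refine ⟨N, q, fun y => ?_, hql, fun a b => ?_⟩
  · obtain ⟨x, hx⟩ := hq.surjective (e.symm y)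
    exact ⟨x, by rw [hqe, hx, e.apply_symm_apply]⟩
  · rw [hqe, hqe, e.injective.eq_iff, horb]

/-- The quotient of `ℂ` by a discrete subgroup. -/
theorem exists_quotient_addSubgroup (Λ : AddSubgroup ℂ) [DiscreteTopology Λ] :
    ∃ (N : An) (q : line ⟶ N), IsQuotientBy q (fun z w : ℂ => w - z ∈ Λ) ∧
      IsCoveringMap (q : ℂ → N) := by
  have hΛ : IsClosed (Λ : Set ℂ) := AddSubgroup.isClosed_of_discrete
  have hq := Λ.isAddQuotientCoveringMap_of_comm ⟨inferInstance⟩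
  have hmk : ∀ a b : ℂ, (a : ℂ ⧸ Λ) = b ↔ b - a ∈ Λ := fun a b => by
    rw [QuotientAddGroup.eq, neg_add_eq_sub]
  obtain ⟨N, e, q, hqe, hql⟩ := exists_quotient (M := line) (N := ℂ ⧸ Λ)
    hq.isCoveringMap.isLocalHomeomorph hq.surjective (fun (a b : ℂ) hab => by
      refine ⟨⟨fun z : ℂ => z + (b - a), ContDiff.contMDiff (by fun_prop)⟩, ?_, fun (x : ℂ) => ?_⟩
      · exact add_sub_cancel a b
      · refine ((hmk x (x + (b - a))).2 ?_).symm
        simpa using (hmk a b).1 hab)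
  have hqe' : (q : ℂ → N) = e ∘ QuotientAddGroup.mk (s := Λ) := funext hqe
  refine ⟨N, q, ⟨fun y => ?_, hql, fun (a b : ℂ) => ?_⟩, ?_⟩
  · obtain ⟨x, hx⟩ := hq.surjective (e.symm y)
    exact ⟨x, (hqe x).trans (by rw [hx, e.apply_symm_apply])⟩
  · exact (Eq.congr (hqe a) (hqe b)).trans (e.injective.eq_iff.trans (hmk a b))
  · rw [hqe']
    exact (hq.homeomorph_comp e).isCoveringMap

/-! ### Quotients of the complex line have genus one -/

section Genus

variable {Z : An} {q : ℂ → Z}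

/-- The derivative of `q : ℂ → Z` in the direction `1`. -/
noncomputable def velocity (q : ℂ → Z) (x : ℂ) : TangentSpace 𝓘(ℂ, Z.Model) (q x) :=
  mfderiv 𝓘(ℂ, ℂ) 𝓘(ℂ, Z.Model) q x (1 : ℂ)

lemma velocity_add (hq : IsLocalDiffeomorph 𝓘(ℂ, ℂ) 𝓘(ℂ, Z.Model) ω q) {c : ℂ}
    (hc : ∀ x, q (x + c) = q x)
    (φ : ∀ y : Z, TangentSpace 𝓘(ℂ, Z.Model) y →L[ℂ] ℂ) (a : ℂ) :
    φ (q (a + c)) (velocity q (a + c)) = φ (q a) (velocity q a) := by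
  -- The tangent spaces at `q (a + c)` and `q a` are distinct types, so the equality of functions `q
  -- (· + c) = q` is substituted as a whole.
  have h1 : ∀ q' : ℂ → Z, q' = q → φ (q' a) (velocity q' a) = φ (q a) (velocity q a) := by
    rintro _ rfl
    rfl
  rw [← h1 (fun x => q (x + c)) (funext hc)]
  have h2 : HasMFDerivAt 𝓘(ℂ, ℂ) 𝓘(ℂ, ℂ) (fun x : ℂ => x + c) a (ContinuousLinearMap.id ℂ ℂ) :=
    ((hasFDerivAt_id a).add_const c).hasMFDerivAt
  have h3 := (((hq.mdifferentiable (by simp)) (a + c)).hasMFDerivAt.comp a h2).mfderiv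
  have h4 : velocity (fun x => q (x + c)) a = velocity q (a + c) := DFunLike.congr_fun h3 (1 : ℂ)
  exact congrArg (φ (q (a + c))) h4.symm

/-- Chain rule for `localInverse ∘ q = id`: each local inverse is a local coordinate whose
differential takes the value one on the velocity. -/
lemma mfderiv_localInverse_velocity (hq : IsLocalDiffeomorph 𝓘(ℂ, ℂ) 𝓘(ℂ, Z.Model) ω q) (x : ℂ) :
    ∀ z ∈ (hq x).localInverse.target,
      mfderiv 𝓘(ℂ, Z.Model) 𝓘(ℂ, ℂ) (hq x).localInverse (q z) (velocity q z) = (1 : ℂ) := by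
  intro z hz
  have h0 : q z ∈ (hq x).localInverse.source := by
    have := (hq x).localInverse.map_target hz
    have h2 := (hq x).localInverse_right_inv this
    have h3 : (hq x).localInverse ((hq x).localInverse.symm z) = z :=
      (hq x).localInverse.right_inv hz
    exact (congrArg q h3).symm.trans h2 ▸ this
  have h1 : MDifferentiableAt 𝓘(ℂ, Z.Model) 𝓘(ℂ, ℂ) (hq x).localInverse (q z) :=
    ((hq x).localInverse_contMDiffOn.contMDiffAt
      ((hq x).localInverse_open_source.mem_nhds h0)).mdifferentiableAt (by simp)
  have h2 := mfderiv_comp z h1 (hq.mdifferentiable (by simp) z)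
  have h3 : (hq x).localInverse ∘ q =ᶠ[𝓝 z] id :=
    Filter.eventuallyEq_of_mem ((hq x).localInverse.open_target.mem_nhds hz)
      (hq x).localInverse_eqOn_left
  rw [h3.mfderiv_eq, mfderiv_id] at h2
  exact (DFunLike.congr_fun h2 (1 : ℂ)).symm

/-- The holomorphic form on a quotient of `ℂ` by translations that is induced by `dz`. -/
noncomputable def formAt (hs : Surjective q)
    (hq : IsLocalDiffeomorph 𝓘(ℂ, ℂ) 𝓘(ℂ, Z.Model) ω q) (y : Z) :
    TangentSpace 𝓘(ℂ, Z.Model) y →L[ℂ] ℂ :=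
  mfderiv 𝓘(ℂ, Z.Model) 𝓘(ℂ, ℂ) (hq (surjInv hs y)).localInverse y

variable (hs : Surjective q) (hq : IsLocalDiffeomorph 𝓘(ℂ, ℂ) 𝓘(ℂ, Z.Model) ω q)
  (hc : ∀ a b, q a = q b → ∀ x, q (x + (b - a)) = q x)

include hq hc in
-- Two preimages of a point differ by a translation preserving `q`, so the velocity is a
-- well-defined vector field on `Z`.
lemma apply_velocity_eq (φ : ∀ y : Z, TangentSpace 𝓘(ℂ, Z.Model) y →L[ℂ] ℂ) {a b : ℂ}
    (h : q a = q b) : φ (q a) (velocity q a) = φ (q b) (velocity q b) := by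
  have := velocity_add hq (hc a b h) φ a
  rw [add_sub_cancel] at this
  exact this.symm

include hc in
-- This normalisation shows that the form does not depend on the preimage selected by `surjInv`.
lemma formAt_velocity (a : ℂ) : formAt hs hq (q a) (velocity q a) = 1 := by
  have h1 := surjInv_eq hs (q a)
  have := apply_velocity_eq hq hc (fun y => mfderiv 𝓘(ℂ, Z.Model) 𝓘(ℂ, ℂ)
    (hq (surjInv hs (q a))).localInverse y) h1
  exact this.symm.trans (mfderiv_localInverse_velocity hq _ _ (hq _).localInverse_mem_target)

lemma exists_smul_velocity (hq : IsLocalDiffeomorph 𝓘(ℂ, ℂ) 𝓘(ℂ, Z.Model) ω q) (a : ℂ)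
    (v : TangentSpace 𝓘(ℂ, Z.Model) (q a)) : ∃ c : ℂ, v = c • velocity q a := by
  obtain ⟨c, rfl⟩ : ∃ c : ℂ, hq.mfderivToContinuousLinearEquiv (by simp) a c = v :=
    (hq.mfderivToContinuousLinearEquiv (by simp) a).surjective v
  refine ⟨c, ?_⟩
  have h : c = c • (1 : ℂ) := (mul_one c).symm
  exact (congrArg (hq.mfderivToContinuousLinearEquiv (by simp) a) h).trans
    ((hq.mfderivToContinuousLinearEquiv (by simp) a).map_smul c (1 : ℂ))

/-- The differential of `q` is an isomorphism, so the velocity spans the tangent line and a covector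
is determined by its value there. -/
lemma form_ext (hq : IsLocalDiffeomorph 𝓘(ℂ, ℂ) 𝓘(ℂ, Z.Model) ω q) {a : ℂ}
    {φ ψ : TangentSpace 𝓘(ℂ, Z.Model) (q a) →L[ℂ] ℂ}
    (h : φ (velocity q a) = ψ (velocity q a)) : φ = ψ := by
  ext v
  obtain ⟨c, rfl⟩ := exists_smul_velocity hq a v
  rw [map_smul, map_smul, h]

include hc in
-- The preimage chosen by `surjInv` may jump, but near `q x` the form agrees with the differential
-- of one fixed local inverse, since both take the value one on the velocity.
lemma contMDiff_formAt :
    ContMDiff 𝓘(ℂ, Z.Model) (𝓘(ℂ, Z.Model).prod 𝓘(ℂ, Z.Model →L[ℂ] ℂ)) ω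
      (fun y => Bundle.TotalSpace.mk' (Z.Model →L[ℂ] ℂ)
        (E := fun x : Z => TangentSpace 𝓘(ℂ, Z.Model) x →L[ℂ] Bundle.Trivial Z ℂ x)
        y (formAt hs hq y)) := by
  intro y
  obtain ⟨x, rfl⟩ := hs y
  have h1 : ContMDiffAt 𝓘(ℂ, Z.Model) (𝓘(ℂ, Z.Model).prod 𝓘(ℂ, Z.Model →L[ℂ] ℂ)) ω
      (fun y => Bundle.TotalSpace.mk' (Z.Model →L[ℂ] ℂ)
        (E := fun x : Z => TangentSpace 𝓘(ℂ, Z.Model) x →L[ℂ] Bundle.Trivial Z ℂ x)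
        y (mfderiv 𝓘(ℂ, Z.Model) 𝓘(ℂ, ℂ) (hq x).localInverse y)) (q x) := by
    rw [contMDiffAt_hom_bundle]
    refine ⟨contMDiffAt_id, ?_⟩
    have := (hq x).localInverse_contMDiffAt.mfderiv_const (m := ω) (by simp)
    refine this.congr_of_eventuallyEq (Filter.Eventually.of_forall fun y => ?_)
    ext v
    simp [inTangentCoordinates, ContinuousLinearMap.inCoordinates]
    rfl
  refine h1.congr_of_eventuallyEq ?_
  filter_upwards [(hq x).localInverse_open_source.mem_nhds (hq x).localInverse_mem_source] with y hy
  obtain ⟨z, hz, rfl⟩ : ∃ z ∈ (hq x).localInverse.target, q z = y :=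
    ⟨_, (hq x).localInverse.map_source hy, (hq x).localInverse_right_inv hy⟩
  congr 1
  refine form_ext hq ?_
  rw [formAt_velocity hs hq hc]
  exact (mfderiv_localInverse_velocity hq x z hz).symm

/-- This is the coefficient of `dz` in the pullback of `η`: the section `η ∘ q` is paired with the
image under the tangent map of `q` of the constant field `1`. -/
lemma contMDiff_form_velocity (hq : IsLocalDiffeomorph 𝓘(ℂ, ℂ) 𝓘(ℂ, Z.Model) ω q)
    (η : Z.HolomorphicForms) :
    ContMDiff 𝓘(ℂ, ℂ) 𝓘(ℂ, ℂ) ω fun x : ℂ => (η (q x) (velocity q x) : ℂ) := by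
  have h1 : ContMDiff 𝓘(ℂ, ℂ) (𝓘(ℂ, Z.Model).prod 𝓘(ℂ, Z.Model →L[ℂ] ℂ)) ω
      (fun x : ℂ => Bundle.TotalSpace.mk' (Z.Model →L[ℂ] ℂ)
        (E := fun x : Z => TangentSpace 𝓘(ℂ, Z.Model) x →L[ℂ] Bundle.Trivial Z ℂ x)
        (q x) (η (q x))) := η.contMDiff.comp hq.contMDiff
  have h2 : ContMDiff 𝓘(ℂ, ℂ) (𝓘(ℂ, ℂ).prod 𝓘(ℂ, ℂ)) ω
      (fun x : ℂ => (Bundle.TotalSpace.mk' ℂ x (1 : ℂ) : TangentBundle 𝓘(ℂ, ℂ) ℂ)) := by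
    intro x
    rw [Bundle.contMDiffAt_totalSpace]
    refine ⟨contMDiffAt_id, ?_⟩
    simpa using contMDiffAt_const
  have h3 : ContMDiff 𝓘(ℂ, ℂ) (𝓘(ℂ, Z.Model).prod 𝓘(ℂ, Z.Model)) ω
      (fun x : ℂ => Bundle.TotalSpace.mk' Z.Model
        (E := fun x : Z => TangentSpace 𝓘(ℂ, Z.Model) x) (q x) (velocity q x)) :=
    (hq.contMDiff.contMDiff_tangentMap (m := ω) (by simp)).comp h2
  have h4 := h1.clm_bundle_apply h3
  intro x
  exact (Bundle.contMDiffAt_totalSpace.1 (h4 x)).2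

include hs hq hc in
/-- A compact quotient of `ℂ` by translations is a curve of genus one. -/
theorem isGenusOneCurve_of_translations (hZ : CompactSpace Z) : Z.IsGenusOneCurve := by
  have hconn : ConnectedSpace Z := hs.connectedSpace hq.contMDiff.continuous
  refine ⟨?_, hZ, hconn, ?_⟩
  · exact ((hq.mfderivToContinuousLinearEquiv (by simp) 0).toLinearEquiv.finrank_eq).symm.trans
      (Module.finrank_self ℂ)
  · let η₀ : Z.HolomorphicForms := ⟨fun y => formAt hs hq y, contMDiff_formAt hs hq hc⟩
    have h0 : ∀ a, η₀ (q a) (velocity q a) = (1 : ℂ) := formAt_velocity hs hq hc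
    refine finrank_eq_one η₀ ?_ ?_
    · intro h
      have := h0 0
      rw [h] at this
      exact zero_ne_one this
    · intro η
      -- The ratio `η / η₀` is a global holomorphic function on a compact connected manifold, hence
      -- constant.
      let g : Z → ℂ := fun y => η (q (surjInv hs y)) (velocity q (surjInv hs y))
      have hg : ∀ a, g (q a) = η (q a) (velocity q a) := fun a =>
        apply_velocity_eq hq hc (fun y => η y) (surjInv_eq hs (q a))
      have hg1 : ContMDiff 𝓘(ℂ, Z.Model) 𝓘(ℂ, ℂ) ω g :=
        contMDiff_of_localDiffeomorph_comp (M := line) hs hq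
          ((contMDiff_form_velocity hq η).congr hg)
      obtain ⟨c, hcg⟩ := (hg1.mdifferentiable (by simp)).exists_eq_const_of_compactSpace
      refine ⟨c, ?_⟩
      ext1 y
      obtain ⟨a, rfl⟩ := hs y
      refine form_ext hq ?_
      have h1 : η (q a) (velocity q a) = c := (hg a).symm.trans (congrFun hcg (q a))
      refine Eq.trans ?_ h1.symm
      change c • η₀ (q a) (velocity q a) = c
      rw [h0]
      exact mul_one c

end Genus

/-! ### Twisted products -/

section Submersion

variable {M N A B : An} {q : M ⟶ N} {p : A ⟶ B} {f : M ⟶ A} {g : N ⟶ B}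

/-- Submersions descend along local biholomorphisms. -/
lemma IsSubmersion.desc (hs : Surjective q)
    (hq : IsLocalDiffeomorph 𝓘(ℂ, M.Model) 𝓘(ℂ, N.Model) ω q)
    (hp : IsLocalDiffeomorph 𝓘(ℂ, A.Model) 𝓘(ℂ, B.Model) ω p)
    (hf : IsSubmersion f) (h : ∀ x, g (q x) = p (f x)) : IsSubmersion g := by
  obtain ⟨F, i1, i2, hF⟩ := hf
  refine ⟨F, i1, i2, fun y => ?_⟩
  obtain ⟨x, rfl⟩ := hs y
  obtain ⟨Q, hxQ, hQ⟩ := hq x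
  obtain ⟨P, hxP, hP⟩ := hp (f x)
  have hF := hF x
  -- The restriction ensures that `f` maps the source into the set on which `p` agrees with the
  -- biholomorphism `P`.
  let Q' := Q.toOpenPartialHomeomorph.restrOpen (f ⁻¹' P.source)
    (P.open_source.preimage f.holomorphic.continuous)
  -- The models of `M` and `N` may be different vector spaces; the derivative of `q` serves only to
  -- identify them, so that a chart of `M` transported by `q` becomes a chart of `N`. The same is
  -- done for `p`.
  let LM : M.Model ≃L[ℂ] N.Model := hq.mfderivToContinuousLinearEquiv (by simp) x
  let LA : A.Model ≃L[ℂ] B.Model := hp.mfderivToContinuousLinearEquiv (by simp) (f x)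
  let d := (Q'.symm.trans hF.domChart).transHomeomorph LM.toHomeomorph
  let c := (P.toOpenPartialHomeomorph.symm.trans hF.codChart).transHomeomorph LA.toHomeomorph
  have hxQ' : x ∈ Q'.source := ⟨hxQ, hxP⟩
  have hQ' : ∀ z ∈ Q'.source, Q' z = q z := fun z hz => (hQ hz.1).symm
  have hP' : ∀ z ∈ P.source, P.toOpenPartialHomeomorph z = p z := fun z hz => (hP hz).symm
  have s1 : ContMDiffOn 𝓘(ℂ, M.Model) 𝓘(ℂ, N.Model) ω Q' Q'.source :=
    Q.contMDiffOn_toFun.mono fun z hz => hz.1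
  have s2 : ContMDiffOn 𝓘(ℂ, N.Model) 𝓘(ℂ, M.Model) ω Q'.symm Q'.target :=
    Q.contMDiffOn_invFun.mono fun z hz => hz.1
  have t1 := contMDiffOn_of_mem_maximalAtlas hF.domChart_mem_maximalAtlas
  have t2 := contMDiffOn_symm_of_mem_maximalAtlas hF.domChart_mem_maximalAtlas
  have u1 := contMDiffOn_of_mem_maximalAtlas hF.codChart_mem_maximalAtlas
  have u2 := contMDiffOn_symm_of_mem_maximalAtlas hF.codChart_mem_maximalAtlas
  have hd : d ∈ IsManifold.maximalAtlas 𝓘(ℂ, N.Model) ω N :=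
    d.mem_maximalAtlas_of_contMDiffOn
      (LM.contDiff.contMDiff.comp_contMDiffOn
        (t1.comp (s2.mono fun z hz => hz.1) fun z hz => hz.2))
      ((s1.comp (t2.mono fun z hz => hz.1) fun z hz => hz.2).comp
        LM.symm.contDiff.contMDiff.contMDiffOn fun z hz => hz)
  have hc : c ∈ IsManifold.maximalAtlas 𝓘(ℂ, B.Model) ω B :=
    c.mem_maximalAtlas_of_contMDiffOn
      (LA.contDiff.contMDiff.comp_contMDiffOn
        (u1.comp (P.contMDiffOn_invFun.mono fun z hz => hz.1) fun z hz => hz.2))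
      ((P.contMDiffOn_toFun.comp (u2.mono fun z hz => hz.1) fun z hz => hz.2).comp
        LA.symm.contDiff.contMDiff.contMDiffOn fun z hz => hz)
  have hxd : q x ∈ d.source := by
    refine ⟨hQ' x hxQ' ▸ Q'.map_source hxQ', ?_⟩
    rw [← hQ' x hxQ']
    exact (congrArg (· ∈ hF.domChart.source) (Q'.left_inv hxQ')).mpr hF.mem_domChart_source
  have hxc : g (q x) ∈ c.source := by
    rw [h]
    refine ⟨hP' _ hxP ▸ P.toOpenPartialHomeomorph.map_source hxP, ?_⟩
    rw [← hP' _ hxP]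
    exact (congrArg (· ∈ hF.codChart.source) (P.toOpenPartialHomeomorph.left_inv hxP)).mpr
      hF.mem_codChart_source
  refine Manifold.IsSubmersionAtOfComplement.mk_of_continuousAt
    g.holomorphic.continuous.continuousAt
    (LM.symm.trans (hF.equiv.trans (LA.prodCongr (ContinuousLinearEquiv.refl ℂ F))))
    d c hxd hxc hd hc fun v hv => ?_
  have hv' : v ∈ d.target := by simpa using hv
  obtain ⟨v1, v2⟩ := hv'
  have e1 : d.symm v = q (hF.domChart.symm (LM.symm v)) := hQ' _ v2
  have e2 : c (p (f (hF.domChart.symm (LM.symm v)))) =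
      LA (hF.codChart (f (hF.domChart.symm (LM.symm v)))) := by
    refine (congrArg c (hP' _ v2.2).symm).trans ?_
    exact congrArg (fun z => LA (hF.codChart z)) (P.toOpenPartialHomeomorph.left_inv v2.2)
  have e3 := submersion_chart_eq hF v1
  have e4 : c (g (d.symm v)) = LA (hF.equiv (LM.symm v)).1 := by
    rw [e1, h, e2]
    exact congrArg LA e3
  exact e4

end Submersion

/-- The fibres of a manifold that is isomorphic to `S × C` over `S`. -/
noncomputable def fibreIsoOfTrivialization {E S C : An} {p : E ⟶ S} (hp : IsSubmersion p)
    (e : prod S C ≅ E) (he : e.hom ≫ p = fst S C) (s : S) : C ≅ fibre p hp s where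
  hom := pullbackLift hp (prodLift (const C s) (𝟙 C) ≫ e.hom) (const C PUnit.unit)
    (by rw [Category.assoc, he]; rfl)
  inv := pullbackFst p hp (point s) ≫ e.inv ≫ snd S C
  hom_inv_id := hom_ext fun z => congrArg Prod.snd
    (congrArg (fun k : prod S C ⟶ prod S C => k (s, z)) e.hom_inv_id)
  inv_hom_id := hom_ext fun y => by
    refine Subtype.ext (Prod.ext ?_ rfl)
    have h1 : e.hom (e.inv y.1.1) = y.1.1 :=
      congrArg (fun k : E ⟶ E => k y.1.1) e.inv_hom_id
    have h2 : (e.inv y.1.1).1 = s := by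
      have := congrArg (fun k : prod S C ⟶ S => k (e.inv y.1.1)) he
      refine this.symm.trans ?_
      exact (congrArg p h1).trans y.2
    have h3 : ((s, (e.inv y.1.1).2) : S × C) = e.inv y.1.1 := Prod.ext h2.symm rfl
    exact (congrArg e.hom h3).trans h1

/-! ### Trivialising the twisted product over the double cover -/

section Twist

variable {X C Y W : An} {τ : X ⟶ X} {ν : C ⟶ C} {p : X ⟶ Y} {q : prod X C ⟶ W} {π : W ⟶ Y}

/-- A twisted product becomes trivial over the double cover. -/
theorem exists_iso_pullback_twist (hfree : ∀ x, τ x ≠ x)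
    (hp : IsQuotientBy p (fun a b : X => b = a ∨ b = τ a))
    (hq : IsQuotientBy q (fun a b : X × C => b = a ∨ b = (τ a.1, ν a.2)))
    (hπ : q ≫ π = fst X C ≫ p) (hsub : IsSubmersion π) :
    ∃ e : prod X C ≅ pullback π hsub p, e.hom = pullbackLift hsub q (fst X C) hπ := by
  let j := pullbackLift hsub q (fst X C) hπ
  have hπ' : ∀ a : X × C, π (q a) = p a.1 := fun a =>
    congrArg (fun k : prod X C ⟶ Y => k a) hπ
  have hj : Bijective j := by
    constructor
    · rintro ⟨x, z⟩ ⟨x', z'⟩ h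
      have h1 : x = x' := congrArg (fun y : FibreProd π p => y.1.2) h
      have h2 : q (x, z) = q (x', z') := congrArg (fun y : FibreProd π p => y.1.1) h
      subst h1
      rcases (hq.2.2 _ _).1 h2 with h3 | h3
      · exact h3.symm
      · exact (hfree x (congrArg Prod.fst h3).symm).elim
    · rintro ⟨⟨w, x⟩, hwx⟩
      obtain ⟨⟨x', z'⟩, rfl⟩ := hq.1 w
      have h1 : p x' = p x := (hπ' (x', z')).symm.trans hwx
      rcases (hp.2.2 _ _).1 h1 with h2 | h2
      · subst h2
        exact ⟨(x, z'), rfl⟩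
      -- Here `x = τ x'`, so the other representative `(τ x', ν z')` of the class of `(x', z')` lies
      -- over `x`.
      · refine ⟨(x, ν z'), Subtype.ext (Prod.ext ?_ rfl)⟩
        exact ((hq.2.2 (x', z') (x, ν z')).2 (Or.inr (by rw [h2]))).symm
  let k := (Equiv.ofBijective j hj).symm
  have hjk : ∀ y, j (k y) = y := (Equiv.ofBijective j hj).apply_symm_apply
  have hkj : ∀ a, k (j a) = a := (Equiv.ofBijective j hj).symm_apply_apply
  -- Near `j a` the inverse is a local inverse of `q` applied to the first projection. What must be
  -- checked is that its `X`-component is the second coordinate of `y`.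
  have hk : ContMDiff 𝓘(ℂ, (pullback π hsub p).Model) 𝓘(ℂ, (prod X C).Model) ω k := by
    intro y
    obtain ⟨a, rfl⟩ := hj.2 y
    have c1 : ContMDiffAt 𝓘(ℂ, (pullback π hsub p).Model) 𝓘(ℂ, (prod X C).Model) ω
        ((hq.2.1 a).localInverse ∘ pullbackFst π hsub p) (j a) :=
      ContMDiffAt.comp (j a) (hq.2.1 a).localInverse_contMDiffAt
        (pullbackFst π hsub p).holomorphic.contMDiffAt
    refine c1.congr_of_eventuallyEq ?_
    have t1 : Filter.Tendsto (pullbackFst π hsub p) (𝓝 (j a)) (𝓝 (q a)) :=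
      (pullbackFst π hsub p).holomorphic.continuous.continuousAt
    have t2 : Filter.Tendsto (pullbackSnd π hsub p) (𝓝 (j a)) (𝓝 (Prod.fst a)) :=
      (pullbackSnd π hsub p).holomorphic.continuous.continuousAt
    have t3 : Filter.Tendsto (fun y => fst X C
        ((hq.2.1 a).localInverse (pullbackFst π hsub p y))) (𝓝 (j a)) (𝓝 (Prod.fst a)) := by
      have := ((fst X C).holomorphic.continuous.tendsto _).comp c1.continuousAt.tendsto
      have e : (hq.2.1 a).localInverse (pullbackFst π hsub p (j a)) = a :=
        (hq.2.1 a).localInverse_left_inv (hq.2.1 a).localInverse_mem_target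
      exact (congrArg (fun b : X × C => 𝓝 b.1) e) ▸ this
    have o1 := (hp.2.1 (Prod.fst a)).localInverse_eventuallyEq_left
    filter_upwards [t1.eventually (hq.2.1 a).localInverse_eventuallyEq_right,
      t2.eventually o1, t3.eventually o1] with y h1 h2 h3
    set b := (hq.2.1 a).localInverse (pullbackFst π hsub p y) with hb
    have h1' : q b = y.1.1 := h1
    have h4 : p b.1 = p y.1.2 := (hπ' b).symm.trans ((congrArg π h1').trans y.2)
    -- Both points have the same image under `p` and lie near `a.1`, where `p` is injective.
    have h5 : b.1 = y.1.2 := by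
      refine Eq.trans h3.symm (Eq.trans ?_ h2)
      exact congrArg (hp.2.1 (Prod.fst a)).localInverse h4
    have h6 : j b = y := Subtype.ext (Prod.ext h1' h5)
    exact (congrArg k h6).symm.trans (hkj b)
  exact ⟨{ hom := j, inv := ⟨k, hk⟩, hom_inv_id := hom_ext hkj, inv_hom_id := hom_ext hjk }, rfl⟩

end Twist

end An

open An

/-! ### The twisted family over the quotient -/

namespace Family

/-- The twisted family `(X × C) / (ℤ/2)` over `Y = X / (ℤ/2)`. -/
theorem exists_twist {X C Y : An} (hC : C.IsGenusOneCurve) {τ : X ⟶ X} {ν : C ⟶ C}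
    {p : X ⟶ Y} (hfree : ∀ x, τ x ≠ x) (hττ : ∀ x, τ (τ x) = x) (hνν : ∀ z, ν (ν z) = z)
    (hp : IsQuotientBy p (fun a b : X => b = a ∨ b = τ a)) {o : C} (ho : ν o = o) :
    ∃ (E : Family Y) (q : An.prod X C ⟶ E.total),
      IsQuotientBy q (fun a b : X × C => b = a ∨ b = (τ a.1, ν a.2)) ∧
      q ≫ E.proj = An.fst X C ≫ p ∧
      p ≫ E.zero = An.prodLift (𝟙 X) (An.const X o) ≫ q ∧
      Nonempty (pull p E ≅ trivial X C hC o) := by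
  let σ : An.prod X C ⟶ An.prod X C := prodLift (An.fst X C ≫ τ) (An.snd X C ≫ ν)
  obtain ⟨W, q, hq⟩ := exists_quotient_involution σ
    (fun a => Prod.ext (hττ _) (hνν _)) (fun a h => hfree _ (congrArg Prod.fst h))
  have hpτ : ∀ x, p (τ x) = p x := fun x => ((hp.2.2 x (τ x)).2 (Or.inr rfl)).symm
  obtain ⟨π, hπ⟩ := hq.exists_desc (An.fst X C ≫ p) (by
    rintro a _ (rfl | rfl)
    · rfl
    · exact (hpτ _).symm)
  have hπ' : q ≫ π = An.fst X C ≫ p := An.hom_ext hπ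
  have hsub : IsSubmersion π :=
    IsSubmersion.desc hq.1 hq.2.1 hp.2.1 (isSubmersion_fst X C) hπ
  -- The section `x ↦ q (x, o)` is invariant under `τ` because `ν` fixes `o`.
  obtain ⟨z, hz⟩ := hp.exists_desc (An.prodLift (𝟙 X) (An.const X o) ≫ q) (by
    rintro a _ (rfl | rfl)
    · rfl
    · refine (hq.2.2 (a, o) (τ a, o)).2 (Or.inr ?_)
      exact Prod.ext rfl ho.symm)
  obtain ⟨e, he⟩ := exists_iso_pullback_twist hfree hp hq hπ' hsub
  have hez : e.hom ≫ pullbackSnd π hsub p = An.fst X C := by rw [he]; rfl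
  let E : Family Y :=
    { total := W
      proj := π
      isSubmersion := hsub
      zero := z
      zero_proj := An.hom_ext fun y => by
        obtain ⟨x, rfl⟩ := hp.1 y
        exact (congrArg π (hz x)).trans (hπ (x, o))
      fibre_genusOne := fun y => by
        obtain ⟨x, rfl⟩ := hp.1 y
        -- The fibre over `p x` is the fibre at `x` of the pulled back family, which is the product
        -- `X × C`.
        exact ⟨C, hC, ⟨fibreIsoOfTrivialization (isSubmersion_pullbackSnd π hsub p) e hez x ≪≫
          (fibrePullbackIso π hsub p x).symm⟩⟩ }
  refine ⟨E, q, hq, hπ', An.hom_ext hz, ⟨(Groupoid.isoEquivHom _ _).symm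
    { iso := e.symm
      iso_proj := ?_
      zero_iso := ?_ }⟩⟩
  · exact (Iso.inv_comp_eq e).2 hez.symm
  · refine (Iso.comp_inv_eq e).2 ?_
    rw [he]
    exact An.hom_ext fun x => Subtype.ext (Prod.ext (hz x) rfl)

end Family

namespace An

/-! ### Rigidity of families of endomorphisms of `ℂ / Λ` -/

/-- A family of pointed endomorphisms of `X = ℂ / Λ`, parametrised by `X`, that is invariant under
`(x, z) ↦ (x + c, -z)` is constant. -/
theorem eq_zero_of_twisted_invariant {X : An} (hX : CompactSpace X) {u : ℂ → X}
    (hs : Surjective u) (hl : IsLocalDiffeomorph 𝓘(ℂ, ℂ) 𝓘(ℂ, X.Model) ω u)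
    (hcov : IsCoveringMap u) (hu : ∀ a b, u a = u b → ∀ x, u (x + (b - a)) = u x)
    {φ : X → X → X} (hφ : Continuous fun a : X × X => φ a.1 a.2)
    (hφ' : ContMDiff 𝓘(ℂ, X.Model) 𝓘(ℂ, X.Model) ω (φ (u 0)))
    (h0 : ∀ x, φ x (u 0) = u 0) {c : ℂ}
    (hc : ∀ x z, φ (u (x + c)) (u (-z)) = φ (u x) (u z)) (z : X) : φ (u 0) z = u 0 := by
  have hconn : ConnectedSpace X := hs.connectedSpace hl.contMDiff.continuous
  have huc : Continuous u := hl.contMDiff.continuous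
  have hper : ∀ l, u l = u 0 → ∀ x, u (x + l) = u x := fun l h x => by
    have := hu 0 l h.symm x
    rwa [sub_zero] at this
  let Φ : C(ℂ × ℂ, X) := ⟨fun a => φ (u a.1) (u a.2), hφ.comp (huc.prodMap huc)⟩
  -- `ℂ × ℂ` is simply connected, so the whole family lifts through the covering to one map with `L
  -- (0, 0) = 0`.
  obtain ⟨L, ⟨hL0, hL⟩, -⟩ := hcov.existsUnique_continuousMap_lifts Φ ((0, 0) : ℂ × ℂ) (0 : ℂ)
    (h0 (u 0)).symm
  have hL' : ∀ x z, u (L (x, z)) = φ (u x) (u z) := fun x z => congrFun hL (x, z)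
  -- At a period `l` the map `x ↦ L (x, l)` lifts a constant map, hence is constant: the action on
  -- periods does not depend on the parameter.
  have hLc : ∀ l, u l = u 0 → ∀ x, L (x, l) = L (0, l) := fun l hl x =>
    hcov.const_of_comp (g := fun x : ℂ => L (x, l)) (by fun_prop)
      (fun a b => by rw [hL', hL', hl, h0, h0]) x 0
  have hLz : ∀ x, L (x, 0) = 0 := fun x => (hLc 0 rfl x).trans hL0
  -- Both sides lift the same map by `hc` and both vanish at the origin.
  have hneg : ∀ x z, L (x + c, -z) = L (x, z) := fun x z =>
    congrFun (hcov.eq_of_comp_eq (g₁ := fun a : ℂ × ℂ => L (a.1 + c, -a.2))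
      (g₂ := fun a => L a) (by fun_prop) (by fun_prop)
      (funext fun a => by
        change u (L (a.1 + c, -a.2)) = u (L a)
        rw [hL', show L a = L (a.1, a.2) from rfl, hL', hc]) (0, 0)
      (by simp only [neg_zero, hLz])) (x, z)
  have hadd : ∀ l, u l = u 0 → ∀ z, L (0, z + l) = L (0, z) + L (0, l) := fun l hl z =>
    congrFun (hcov.eq_of_comp_eq (g₁ := fun z : ℂ => L (0, z + l))
      (g₂ := fun z => L (0, z) + L (0, l)) (by fun_prop) (by fun_prop)
      (funext fun z => by
        change u (L (0, z + l)) = u (L (0, z) + L (0, l))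
        rw [hper (L (0, l)) (by rw [hL', hl, h0]), hL', hL', hper l hl]) 0
      (by simp only [zero_add, hLz])) z
  have hzero : ∀ l, u l = u 0 → L (0, l) = 0 := fun l hl => by
    have hl' : u (-l) = u 0 := by
      have := hper l hl (-l)
      rwa [neg_add_cancel, eq_comm] at this
    have h1 := hadd l hl (-l)
    -- Passing from parameter `0` to `c` costs nothing on periods, whereas the twist reverses the
    -- sign of `l`. With additivity this gives `L (0, l) = -L (0, l)`.
    have h2 : L (0, -l) = L (0, l) := (hLc _ hl' (0 + c)).symm.trans (hneg 0 l)
    rw [neg_add_cancel, hLz, h2] at h1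
    exact self_eq_neg.1 (eq_neg_of_add_eq_zero_left h1.symm)
  have hinv : ∀ a b, u a = u b → L (0, a) = L (0, b) := fun a b h => by
    have hl : u (b - a) = u 0 := by simpa using hu a b h 0
    have := hadd (b - a) hl a
    rw [add_sub_cancel, hzero _ hl, add_zero] at this
    exact this.symm
  have hLcont : Continuous fun z : ℂ => L (0, z) := by fun_prop
  have hhol : ContMDiff 𝓘(ℂ, ℂ) 𝓘(ℂ, ℂ) ω fun z : ℂ => L (0, z) :=
    contMDiff_of_comp_localDiffeomorph (M := line) (q := u) hl hLcont
      ((hφ'.comp hl.contMDiff).congr fun z => hL' 0 z)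
  -- Since all its periods are killed, `L (0, ·)` descends to a holomorphic function on the compact
  -- connected `X`, which is constant and vanishes at `u 0`.
  let g : X → ℂ := fun y => L (0, surjInv hs y)
  have hg : ∀ a, g (u a) = L (0, a) := fun a => hinv _ _ (surjInv_eq hs (u a))
  have hg1 : ContMDiff 𝓘(ℂ, X.Model) 𝓘(ℂ, ℂ) ω g :=
    contMDiff_of_localDiffeomorph_comp (M := line) hs hl (hhol.congr hg)
  obtain ⟨d, hd⟩ := (hg1.mdifferentiable (by simp)).exists_eq_const_of_compactSpace
  have hconst : ∀ a, L (0, a) = 0 := fun a =>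
    (hg a).symm.trans (((congrFun hd (u a)).trans (congrFun hd (u 0)).symm).trans ((hg 0).trans (hLz 0)))
  obtain ⟨a, rfl⟩ := hs z
  rw [← hL', hconst]

end An

/-! ### Automorphisms and representability -/

namespace Family

/-- The automorphism of a trivial family induced by an involution of the fibre. -/
noncomputable def trivialAut (S C : An) (hC : C.IsGenusOneCurve) {o : C} {ν : C ⟶ C}
    (hν : ∀ z, ν (ν z) = z) (ho : ν o = o) : trivial S C hC o ⟶ trivial S C hC o where
  iso :=
    { hom := An.prodLift (An.fst S C) (An.snd S C ≫ ν)
      inv := An.prodLift (An.fst S C) (An.snd S C ≫ ν)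
      hom_inv_id := An.hom_ext fun a => Prod.ext rfl (hν a.2)
      inv_hom_id := An.hom_ext fun a => Prod.ext rfl (hν a.2) }
  iso_proj := rfl
  zero_iso := An.hom_ext fun _ => Prod.ext rfl ho

/-- The pullback of a trivial family is trivial. -/
theorem nonempty_pull_trivial_iso {S T C : An} (f : T ⟶ S) (hC : C.IsGenusOneCurve) (o : C) :
    Nonempty (pull f (trivial S C hC o) ≅ trivial T C hC o) :=
  ⟨(Groupoid.isoEquivHom _ _).symm
    { iso :=
        { hom := An.prodLift (pullbackSnd (An.fst S C) (isSubmersion_fst S C) f)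
            (pullbackFst (An.fst S C) (isSubmersion_fst S C) f ≫ An.snd S C)
          inv := pullbackLift (isSubmersion_fst S C)
            (An.prodLift (An.fst T C ≫ f) (An.snd T C)) (An.fst T C) rfl
          hom_inv_id := An.hom_ext fun y => Subtype.ext (Prod.ext (Prod.ext y.2.symm rfl) rfl)
          inv_hom_id := rfl }
      iso_proj := rfl
      zero_iso := rfl }⟩

/-- A twisted family is not trivial. -/
theorem not_nonempty_twist_iso_trivial {X Y : An} (hX : X.IsGenusOneCurve) {u : line ⟶ X}
    {Λ : AddSubgroup ℂ} (hu : IsQuotientBy u (fun z w : ℂ => w - z ∈ Λ))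
    (hcov : IsCoveringMap (u : ℂ → X)) {τ ν : X ⟶ X} {c : ℂ}
    (hτ : ∀ z : ℂ, τ (u z) = u (z + c : ℂ)) (hν : ∀ z : ℂ, ν (u z) = u (-z : ℂ))
    (hfree : ∀ x, τ x ≠ x) {p : X ⟶ Y} (E : Family Y) {q : An.prod X X ⟶ E.total}
    (hq : IsQuotientBy q (fun a b : X × X => b = a ∨ b = (τ a.1, ν a.2)))
    (hπ : q ≫ E.proj = An.fst X X ≫ p)
    (hz : p ≫ E.zero = An.prodLift (𝟙 X) (An.const X (u (0 : ℂ))) ≫ q) :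
    ¬ Nonempty (E ≅ trivial Y X hX (u (0 : ℂ))) := by
  rintro ⟨v⟩
  let w := (Groupoid.isoEquivHom _ _ v).iso
  have hwp : w.hom ≫ An.fst Y X = E.proj := (Groupoid.isoEquivHom _ _ v).iso_proj
  have hwz : E.zero ≫ w.hom = An.prodLift (𝟙 Y) (An.const Y (u (0 : ℂ))) :=
    (Groupoid.isoEquivHom _ _ v).zero_iso
  -- The fibre component of the trivialisation, pulled back to `X × X`; it inherits invariance under
  -- the twist from `q`.
  let φ : An.prod X X ⟶ X := q ≫ w.hom ≫ An.snd Y X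
  have hinj : ∀ x z z', φ (x, z) = φ (x, z') → z = z' := by
    intro x z z' h
    have h1 : ∀ z, (w.hom (q (x, z))).1 = p x := fun z =>
      (congrArg (fun k : E.total ⟶ Y => k (q (x, z))) hwp).trans
        (congrArg (fun k : An.prod X X ⟶ Y => k (x, z)) hπ)
    have h2 : w.hom (q (x, z)) = w.hom (q (x, z')) := Prod.ext ((h1 z).trans (h1 z').symm) h
    have h3 : ∀ y, w.inv (w.hom y) = y := fun y =>
      congrArg (fun k : E.total ⟶ E.total => k y) w.hom_inv_id
    have h4 : q (x, z) = q (x, z') := (h3 _).symm.trans ((congrArg w.inv h2).trans (h3 _))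
    rcases (hq.2.2 _ _).1 h4 with h5 | h5
    · exact (congrArg Prod.snd h5).symm
    · exact (hfree x (congrArg Prod.fst h5).symm).elim
  have h0 : ∀ x, φ (x, u (0 : ℂ)) = u (0 : ℂ) := fun x =>
    (congrArg (fun b => (w.hom b).2)
      (congrArg (fun k : X ⟶ E.total => k x) hz)).symm.trans
      (congrArg (fun k : Y ⟶ An.prod Y X => (k (p x)).2) hwz)
  have hinv : ∀ x z : X, φ (τ x, ν z) = φ (x, z) := fun x z =>
    congrArg (fun b => (w.hom b).2) ((hq.2.2 (x, z) (τ x, ν z)).2 (Or.inr rfl)).symm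
  have hconst := eq_zero_of_twisted_invariant hX.compactSpace (u := u) hu.1 hu.2.1 hcov
    (fun a b h x => (hu.2.2 _ _).2 (by
      have := Λ.neg_mem ((hu.2.2 _ _).1 h)
      rwa [← show x - (x + (b - a)) = -(b - a) by ring] at this))
    (φ := fun x z => φ (x, z)) φ.holomorphic.continuous
    (An.prodLift (An.const X (u (0 : ℂ))) (𝟙 X) ≫ φ).holomorphic h0 (c := c)
    (fun x z => by rw [← hτ, ← hν, hinv])
  -- `φ (u 0, ·)` is both injective and constant, but `τ (u 0)` and `u 0` are distinct points of
  -- `X`.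
  exact hfree (u (0 : ℂ)) (hinj (u (0 : ℂ)) _ _ ((hconst _).trans (hconst _).symm))

end Family

open scoped Pseudofunctor.StrongTrans in
/-- Families parametrised by the points of a manifold have no nontrivial automorphisms. -/
theorem Prestack.IsRepresentableBy.aut_eq {F : Prestack} {X : An} (h : F.IsRepresentableBy X)
    {S : LocallyDiscrete Anᵒᵖ} {a b : F.toPseudofunctor.obj S} (f g : a ⟶ b) : f = g := by
  obtain ⟨e⟩ := h
  have h1 : (e.hom.app S).toFunctor.map f = (e.hom.app S).toFunctor.map g :=
    Points.subsingleton_hom _ _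
  -- Faithfulness is extracted from the unit of the equivalence: by naturality the image of a
  -- morphism under the round trip determines it, because `η` has the left inverse `θ` after it.
  let η := (e.unit.hom.as.app S).toNatTrans
  let θ := (e.unit.inv.as.app S).toNatTrans
  have h2 : η.app b ≫ θ.app b = 𝟙 b :=
    congrArg (fun m : 𝟙 F.toPseudofunctor ⟶ 𝟙 F.toPseudofunctor =>
      (m.as.app S).toNatTrans.app b) e.unit.hom_inv_id
  have h3 : ∀ k : a ⟶ b, k ≫ η.app b = η.app a ≫
      (e.inv.app S).toFunctor.map ((e.hom.app S).toFunctor.map k) := fun k => η.naturality k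
  have h4 : f ≫ η.app b = g ≫ η.app b := by rw [h3, h3, h1]
  have h5 : ∀ k : a ⟶ b, (k ≫ η.app b) ≫ θ.app b = k := fun k =>
    (Category.assoc _ _ _).trans ((congrArg (k ≫ ·) h2).trans (Category.comp_id k))
  exact (h5 f).symm.trans ((congrArg (· ≫ θ.app b) h4).trans (h5 g))

/-! ### The curves `ℂ / (ℤ + ℤ i)` and `ℂ / (½ ℤ + ℤ i)` -/

/-- The Gaussian integers, as a lattice in `ℂ`. -/
def gaussianLattice : AddSubgroup ℂ where
  carrier := {z | ∃ m n : ℤ, z = (m : ℂ) + (n : ℂ) * Complex.I}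
  zero_mem' := ⟨0, 0, by simp⟩
  add_mem' := by
    rintro _ _ ⟨m, n, rfl⟩ ⟨m', n', rfl⟩
    exact ⟨m + m', n + n', by push_cast; ring⟩
  neg_mem' := by
    rintro _ ⟨m, n, rfl⟩
    exact ⟨-m, -n, by push_cast; ring⟩

lemma mem_gaussianLattice {z : ℂ} :
    z ∈ gaussianLattice ↔ ∃ m n : ℤ, z = (m : ℂ) + (n : ℂ) * Complex.I := Iff.rfl

/-- The real and imaginary parts of a lattice element are integers, so an element of norm less than
one is zero. -/
instance : DiscreteTopology gaussianLattice := by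
  refine discreteTopology_of_isOpen_singleton_zero ?_
  refine Metric.isOpen_singleton_iff.2 ⟨1, one_pos, ?_⟩
  rintro ⟨_, m, n, rfl⟩ h
  rw [Subtype.dist_eq, AddSubgroup.coe_zero, dist_zero_right] at h
  have hm : m = 0 := by
    have := (Complex.abs_re_le_norm _).trans_lt h
    simp only [Complex.add_re, Complex.intCast_re, Complex.mul_re, Complex.I_re, mul_zero,
      Complex.intCast_im, Complex.I_im, mul_one, sub_self, add_zero] at this
    exact Int.abs_lt_one_iff.1 (by exact_mod_cast this)
  have hn : n = 0 := by
    have := (Complex.abs_im_le_norm _).trans_lt h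
    simp only [Complex.add_im, Complex.intCast_im, Complex.mul_im, Complex.intCast_re,
      Complex.I_re, mul_zero, Complex.I_im, mul_one, add_zero, zero_add] at this
    exact Int.abs_lt_one_iff.1 (by exact_mod_cast this)
  subst hm hn
  ext
  simp

lemma half_notMem_gaussianLattice : (1 / 2 : ℂ) ∉ gaussianLattice := by
  rintro ⟨m, n, h⟩
  have h1 := congrArg Complex.re h
  simp only [Complex.add_re, Complex.intCast_re, Complex.mul_re, Complex.I_re, mul_zero,
    Complex.intCast_im, Complex.I_im, mul_one, sub_self, add_zero] at h1
  norm_num at h1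
  have h2 : (1 : ℝ) = ((2 * m : ℤ) : ℝ) := by push_cast; linarith
  have h3 : (1 : ℤ) = 2 * m := by exact_mod_cast h2
  omega

/-- The unit square is a fundamental domain of the Gaussian integers. -/
lemma compactSpace_of_gaussianLattice {X : Type} [TopologicalSpace X] {u : ℂ → X}
    (hc : Continuous u) (hs : Surjective u)
    (hu : ∀ z w, w - z ∈ gaussianLattice → u z = u w) : CompactSpace X := by
  let K : Set ℂ := (fun a : ℝ × ℝ => (a.1 + a.2 * Complex.I : ℂ)) '' (Icc 0 1 ×ˢ Icc 0 1)
  have hK : IsCompact K := (isCompact_Icc.prod isCompact_Icc).image (by fun_prop)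
  refine ⟨?_⟩
  convert hK.image hc
  refine (eq_univ_of_forall fun y => ?_).symm
  obtain ⟨z, rfl⟩ := hs y
  refine ⟨_, ⟨(Int.fract z.re, Int.fract z.im), ⟨⟨Int.fract_nonneg _, (Int.fract_lt_one _).le⟩,
    ⟨Int.fract_nonneg _, (Int.fract_lt_one _).le⟩⟩, rfl⟩, hu _ _ ⟨⌊z.re⌋, ⌊z.im⌋, ?_⟩⟩
  have h1 : ((Int.fract z.re : ℝ) : ℂ) = z.re - ⌊z.re⌋ := by
    rw [← Int.self_sub_floor]; push_cast; rfl
  have h2 : ((Int.fract z.im : ℝ) : ℂ) = z.im - ⌊z.im⌋ := by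
    rw [← Int.self_sub_floor]; push_cast; rfl
  simp only [h1, h2]
  linear_combination -Complex.re_add_im z

/-- The quotient of `ℂ / (ℤ + ℤ i)` by `[x] ↦ [x + 1/2]` is a curve of genus one. -/
lemma isGenusOneCurve_half_quotient {X Y : An} {u : line ⟶ X}
    (hu : IsQuotientBy u (fun z w : ℂ => w - z ∈ gaussianLattice)) {τ : X ⟶ X}
    (hτ : ∀ z : ℂ, τ (u z) = u (z + 1 / 2 : ℂ)) {p : X ⟶ Y}
    (hp : IsQuotientBy p (fun a b : X => b = a ∨ b = τ a)) (hX : CompactSpace X) :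
    Y.IsGenusOneCurve := by
  refine isGenusOneCurve_of_translations (q := fun z : ℂ => p (u z)) (hp.1.comp hu.1)
    (fun z => (hu.2.1 z).comp 𝓘(ℂ, Y.Model) Y (hp.2.1 (u z))) ?_ (hp.1.compactSpace p.holomorphic.continuous)
  -- Whether two points have the same image in `Y` depends only on their difference, so `ℂ → Y` is
  -- again a quotient by translations, namely by the lattice `½ ℤ + ℤ i`.
  have key : ∀ z w : ℂ, p (u z) = p (u w) ↔
      w - z ∈ gaussianLattice ∨ w - (z + 1 / 2) ∈ gaussianLattice := by
    intro z w
    refine (hp.2.2 _ _).trans (or_congr ?_ ?_)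
    · exact eq_comm.trans (hu.2.2 z w)
    · exact eq_comm.trans ((Eq.congr (hτ z) rfl).trans (hu.2.2 (z + 1 / 2 : ℂ) w))
  intro a b hab x
  refine ((key _ _).2 ?_).symm
  rw [key] at hab
  rwa [show x + (b - a) - x = b - a by ring,
    show x + (b - a) - (x + 1 / 2) = b - (a + 1 / 2) by ring]

/-- A genus one curve with a nontrivial pointed involution gives a family with a nontrivial
automorphism. -/
lemma not_isRepresentableBy {X : An} (hX : X.IsGenusOneCurve) {o : X} {ν : X ⟶ X}
    (hν : ∀ z, ν (ν z) = z) (ho : ν o = o) {z : X} (hz : ν z ≠ z) (M : An) :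
    ¬ M₁₁.IsRepresentableBy M := by
  intro h
  -- The one-point base already suffices: the curve itself is a family with a nontrivial
  -- automorphism.
  have h1 : Family.trivialAut pt X hX hν ho = 𝟙 (Family.trivial pt X hX o) :=
    h.aut_eq (S := ⟨Opposite.op pt⟩) _ _
  have h2 := congrArg (fun v : Family.trivial pt X hX o ⟶ Family.trivial pt X hX o =>
    v.iso.hom (PUnit.unit, z)) h1
  exact hz (congrArg Prod.snd h2)

end EllipticStack

/-! ### The proposition -/

theorem mainTheorem4 :
    (¬ ∃ M : EllipticStack.An, EllipticStack.M₁₁.IsRepresentableBy M) ∧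
    ∃ (X : EllipticStack.An) (hX : X.IsGenusOneCurve) (u : EllipticStack.An.line ⟶ X)
      (τ ν : X ⟶ X) (Y : EllipticStack.An) (p : X ⟶ Y)
      (E₁ : EllipticStack.Family Y) (q : EllipticStack.An.prod X X ⟶ E₁.total),
      -- `X = ℂ / (ℤ + ℤ i)`, with its maps `[x] ↦ [x + 1/2]` and `[z] ↦ [-z]`
      EllipticStack.An.IsQuotientBy u
        (fun z w : ℂ => ∃ m n : ℤ, w - z = (m : ℂ) + (n : ℂ) * Complex.I) ∧
      (∀ z : ℂ, τ (u z) = u (z + 1 / 2 : ℂ)) ∧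
      (∀ z : ℂ, ν (u z) = u (-z : ℂ)) ∧
      -- `Y = X / (ℤ/2)` is a curve of genus one
      EllipticStack.An.IsQuotientBy p (fun x x' : X => x' = x ∨ x' = τ x) ∧
      Y.IsGenusOneCurve ∧
      -- `E₁ = (X × X) / (ℤ/2)`, with the projection and the section induced by those of `X × X`
      EllipticStack.An.IsQuotientBy q (fun a b : X × X => b = a ∨ b = (τ a.1, ν a.2)) ∧
      q ≫ E₁.proj = EllipticStack.An.fst X X ≫ p ∧
      p ≫ E₁.zero =
        EllipticStack.An.prodLift (𝟙 X) (EllipticStack.An.const X (u (0 : ℂ))) ≫ q ∧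
      -- `E₁` is not trivial, but it becomes so over `X`, as the trivial family does
      ¬ Nonempty (E₁ ≅ EllipticStack.Family.trivial Y X hX (u (0 : ℂ))) ∧
      Nonempty (EllipticStack.Family.pull p E₁ ≅
        EllipticStack.Family.trivial X X hX (u (0 : ℂ))) ∧
      Nonempty (EllipticStack.Family.pull p (EllipticStack.Family.trivial Y X hX (u (0 : ℂ))) ≅
        EllipticStack.Family.trivial X X hX (u (0 : ℂ))) := by
  obtain ⟨X, u, hu, hcov⟩ := EllipticStack.An.exists_quotient_addSubgroup EllipticStack.gaussianLattice
  have hmk : ∀ z w : ℂ, u z = u w ↔ w - z ∈ EllipticStack.gaussianLattice := hu.2.2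
  have hus : ∀ x, ∃ z : ℂ, u z = x := hu.1
  have hXc : CompactSpace X := EllipticStack.compactSpace_of_gaussianLattice (u := u) u.holomorphic.continuous
    hu.1 fun z w h => (hmk z w).2 h
  have hX : X.IsGenusOneCurve := EllipticStack.An.isGenusOneCurve_of_translations (q := u) hu.1 hu.2.1
    (fun a b h x => (hmk _ _).2 (by
      have := EllipticStack.gaussianLattice.neg_mem ((hmk _ _).1 h)
      rwa [← show x - (x + (b - a)) = -(b - a) by ring] at this)) hXc
  let T : EllipticStack.An.line ⟶ EllipticStack.An.line := ⟨fun z : ℂ => (z + 1 / 2 : ℂ), ContDiff.contMDiff (by fun_prop)⟩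
  let N : EllipticStack.An.line ⟶ EllipticStack.An.line := ⟨fun z : ℂ => (-z : ℂ), ContDiff.contMDiff (by fun_prop)⟩
  obtain ⟨τ, hτ⟩ : ∃ τ : X ⟶ X, ∀ z : ℂ, τ (u z) = u (z + 1 / 2 : ℂ) :=
    hu.exists_desc (T ≫ u) fun (a b : ℂ) (h : b - a ∈ EllipticStack.gaussianLattice) =>
      (hmk (a + 1 / 2) (b + 1 / 2)).2 (by rwa [add_sub_add_right_eq_sub])
  obtain ⟨ν, hν⟩ : ∃ ν : X ⟶ X, ∀ z : ℂ, ν (u z) = u (-z : ℂ) :=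
    hu.exists_desc (N ≫ u) fun (a b : ℂ) (h : b - a ∈ EllipticStack.gaussianLattice) =>
      (hmk (-a) (-b)).2 (by
        rw [show -b - -a = -(b - a) by ring]
        exact EllipticStack.gaussianLattice.neg_mem h)
  have hττ : ∀ x, τ (τ x) = x := fun x => by
    obtain ⟨z, rfl⟩ := hus x
    refine (congrArg τ (hτ z)).trans ((hτ _).trans ((hmk _ z).2 ?_))
    exact ⟨-1, 0, by push_cast; ring⟩
  have hνν : ∀ x, ν (ν x) = x := fun x => by
    obtain ⟨z, rfl⟩ := hus x
    exact (congrArg ν (hν z)).trans ((hν _).trans (congrArg u (neg_neg (z : ℂ))))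
  have hfree : ∀ x, τ x ≠ x := fun x h => by
    obtain ⟨z, rfl⟩ := hus x
    have h1 := (hmk _ _).1 (h.symm.trans (hτ z))
    rw [add_sub_cancel_left] at h1
    exact EllipticStack.half_notMem_gaussianLattice h1
  have ho : ν (u (0 : ℂ)) = u (0 : ℂ) := (hν 0).trans (congrArg u (neg_zero (G := ℂ)))
  -- The point `[1/4]` is not fixed by `[z] ↦ [-z]`, since `2 · 1/4 = 1/2` is not in the lattice.
  have hνne : ν (u (1 / 4 : ℂ)) ≠ u (1 / 4 : ℂ) := fun h => by
    have h1 := (hmk _ _).1 ((hν _).symm.trans h)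
    rw [show (1 / 4 : ℂ) - -(1 / 4) = 1 / 2 by norm_num] at h1
    exact EllipticStack.half_notMem_gaussianLattice h1
  obtain ⟨Y, p, hp⟩ := EllipticStack.An.exists_quotient_involution τ hττ hfree
  obtain ⟨E, q, hq, hπ, hz, hpull⟩ := EllipticStack.Family.exists_twist hX hfree hττ hνν hp ho
  exact ⟨fun ⟨M, hM⟩ => EllipticStack.not_isRepresentableBy hX hνν ho hνne M hM,
    X, hX, u, τ, ν, Y, p, E, q, hu, hτ, hν, hp, EllipticStack.isGenusOneCurve_half_quotient hu hτ hp hXc, hq,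
    hπ, hz, EllipticStack.Family.not_nonempty_twist_iso_trivial hX hu hcov hτ hν hfree E hq hπ hz, hpull,
    EllipticStack.Family.nonempty_pull_trivial_iso p hX _⟩
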